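/- **Setting (two-level co-kriging model).** Let $D\subseteq\mathbb R^d$, let $f_1:D\to\mathbb R^{p_1}$, $f_2:D\to\mathbb R^{p_2}$ be vectors of regression functions and let $(x,x')\mapsto r_t(x-x')$, $t=1,2$, be correlation functions on $D$ (hyper-parameters are fixed). Given the parameters $(\sigma_1^2,\beta_1,\sigma_2^2,\rho,\beta_2)$ with $\sigma_1^2,\sigma_2^2>0$, $\beta_1\in\mathbb R^{p_1}$, $\rho\in\mathbb R$, $\beta_2\in\mathbb R^{p_2}$, the processes $Z_1$ and $\delta$ on $D$ are independent Gaussian processes with means $f_1(x)^T\beta_1$, $f_2(x)^T\beta_2$ and covariances $\sigma_1^2r_1(x-x')$, $\sigma_2^2r_2(x-x')$, and $Z_2(x)=\rho Z_1(x)+\delta(x)$. Let $D_1=(x^{(1)}_1,\dots,x^{(1)}_{n_1})$ and $D_2=(x^{(2)}_1,\dots,x^{(2)}_{n_2})$ be designs in $D$ with $D_2\subseteq D_1$, let $z_1=Z_1(D_1)$, $z_2=Z_2(D_2)$, let $z_1(D_2)$ be the vector of those entries of $z_1$ that belong to the points of $D_2$, let $F_t$ be the matrix with rows $f_t(x_i^{(t)})^T$,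 let $R_t=[r_t(x_i^{(t)}-x_j^{(t)})]_{i,j}$ be positive definite, and put $\lambda=(\rho,\beta_2)$ and $F=[\,z_1(D_2)\;\;F_2\,]$ (an $n_2\times(1+p_2)$ matrix depending on $z_1$). $\mathcal{IG}(\alpha,q)$ is the distribution with density $\frac{q^\alpha}{\Gamma(\alpha)}\frac{e^{-q/x}}{x^{\alpha+1}}1_{x>0}$. The joint density of the observations given the parameters is $p(z_1|\beta_1,\sigma_1^2)\,p(z_2|z_1,\lambda,\sigma_2^2)$, where $p(z_1|\beta_1,\sigma_1^2)$ is the density of $\mathcal N(F_1\beta_1,\sigma_1^2R_1)$ at $z_1$ and $p(z_2|z_1,\lambda,\sigma_2^2)$ that of $\mathcal N(F\lambda,\sigma_2^2R_2)$ at $z_2$. **Priors.** Case (I), informative: $[\beta_1|\sigma_1^2]\sim\mathcal N(b_1,\sigma_1^2V_1)$, $[\sigma_1^2]\sim\mathcal{IG}(\alpha_1,\gamma_1)$, $[\lambda|z_1,\sigma_2^2]\sim\mathcal N(b_\lambda,\sigma_2^2V_\lambda)$, $[\sigma_2^2|z_1]\sim\mathcal{IG}(\alpha_2,\gamma_2)$,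 where $V_1,V_\lambda$ are diagonal with positive diagonal entries and $\alpha_1,\gamma_1,\alpha_2,\gamma_2>0$. Case (II), non-informative (improper) Jeffreys priors: $p(\beta_1|\sigma_1^2)\propto1$, $p(\sigma_1^2)\propto1/\sigma_1^2$, $p(\lambda|z_1,\sigma_2^2)\propto1$, $p(\sigma_2^2|z_1)\propto1/\sigma_2^2$; posteriors are then defined by the Bayes formula, i.e. as the normalized product of likelihood and prior. **Claim.** For $i\in\{\mathrm{I},\mathrm{II}\}$, $$[\beta_1|z_1,\sigma_1^2]\sim\mathcal N(A_i^1\nu_i^1,A_i^1),\quad[(\rho,\beta_2)|z_1,z_2,\sigma_2^2]\sim\mathcal N(A_i^\lambda\nu_i^\lambda,A_i^\lambda),$$ $$[\sigma_1^2|z_1]\sim\mathcal{IG}\big(\alpha_i^{\sigma_1^2|n_1},Q_i^1/2\big),\quad[\sigma_2^2|z_1,z_2]\sim\mathcal{IG}\big(\alpha_i^{\sigma_2^2|n_2},Q_i^2/2\big),$$ with $$A_{\mathrm I}^1=\Big[F_1^T\tfrac{R_1^{-1}}{\sigma_1^2}F_1+\tfrac{V_1^{-1}}{\sigma_1^2}\Big]^{-1},\quad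 A_{\mathrm{II}}^1=\Big[F_1^T\tfrac{R_1^{-1}}{\sigma_1^2}F_1\Big]^{-1},\quad\nu_{\mathrm I}^1=F_1^T\tfrac{R_1^{-1}}{\sigma_1^2}z_1+\tfrac{V_1^{-1}}{\sigma_1^2}b_1,\quad\nu_{\mathrm{II}}^1=F_1^T\tfrac{R_1^{-1}}{\sigma_1^2}z_1,$$ $$A_{\mathrm I}^\lambda=\Big[F^T\tfrac{R_2^{-1}}{\sigma_2^2}F+\tfrac{V_\lambda^{-1}}{\sigma_2^2}\Big]^{-1},\quad A_{\mathrm{II}}^\lambda=\Big[F^T\tfrac{R_2^{-1}}{\sigma_2^2}F\Big]^{-1},\quad\nu_{\mathrm I}^\lambda=F^T\tfrac{R_2^{-1}}{\sigma_2^2}z_2+\tfrac{V_\lambda^{-1}}{\sigma_2^2}b_\lambda,\quad\nu_{\mathrm{II}}^\lambda=F^T\tfrac{R_2^{-1}}{\sigma_2^2}z_2,$$ $$\hat\beta_1=(F_1^TR_1^{-1}F_1)^{-1}F_1^TR_1^{-1}z_1,\qquad\hat\lambda=(F^TR_2^{-1}F)^{-1}F^TR_2^{-1}z_2,$$ $$Q_{\mathrm{II}}^1=z_1^T\big[R_1^{-1}-R_1^{-1}F_1(F_1^TR_1^{-1}F_1)^{-1}F_1^TR_1^{-1}\big]z_1,\qquad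 Q_{\mathrm{II}}^2=z_2^T\big[R_2^{-1}-R_2^{-1}F(F^TR_2^{-1}F)^{-1}F^TR_2^{-1}\big]z_2,$$ $$Q_{\mathrm I}^1=2\gamma_1+(b_1-\hat\beta_1)^T\big(V_1+[F_1^TR_1^{-1}F_1]^{-1}\big)^{-1}(b_1-\hat\beta_1)+Q_{\mathrm{II}}^1,$$ $$Q_{\mathrm I}^2=2\gamma_2+(b_\lambda-\hat\lambda)^T\big(V_\lambda+[F^TR_2^{-1}F]^{-1}\big)^{-1}(b_\lambda-\hat\lambda)+Q_{\mathrm{II}}^2,$$ $$\alpha_{\mathrm I}^{\sigma_1^2|n_1}=\tfrac{n_1}2+\alpha_1,\quad\alpha_{\mathrm{II}}^{\sigma_1^2|n_1}=\tfrac{n_1-p_1}2,\quad\alpha_{\mathrm I}^{\sigma_2^2|n_2}=\tfrac{n_2}2+\alpha_2,\quad\alpha_{\mathrm{II}}^{\sigma_2^2|n_2}=\tfrac{n_2-p_2-1}2.$$ In case (I) these are conditional distributions, valid for almost every value of the conditioning variables; the inverse-gamma formulas are asserted where $F_1$, respectively $F=F(z_1)$, has linearly independent columns. In case (II) they hold for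 all observations $z_1$, respectively $(z_1,z_2)$, such that $F_1$, respectively $F$, has linearly independent columns and, for the inverse-gamma formulas, $z_1$, respectively $z_2$, is not in the column space of that matrix; the normalizing constants in the Bayes formula are then finite and positive. -/

import Mathlib

open MeasureTheory ProbabilityTheory Matrix
open scoped ENNReal

noncomputable section

namespace CoKriging

/-- Density of the inverse gamma distribution with shape `α` and scale `q`. -/
def invGammaPDF (α q x : ℝ) : ℝ :=
  if 0 < x then q ^ α / Real.Gamma α * (Real.exp (-(q / x)) / x ^ (α + 1)) else 0

/-- The inverse gamma distribution on the real line. -/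
def invGamma (α q : ℝ) : Measure ℝ :=
  volume.withDensity fun x => ENNReal.ofReal (invGammaPDF α q x)

section Regression

variable {ι κ : Type*} [Fintype ι] [DecidableEq ι] [Fintype κ] [DecidableEq κ]

/-- The quadratic form `vᵀ M v`. -/
def quad (M : Matrix ι ι ℝ) (v : EuclideanSpace ℝ ι) : ℝ :=
  v.ofLp ⬝ᵥ (M *ᵥ v.ofLp)

/-- The product `M v`, as a Euclidean vector. -/
def mulE (M : Matrix ι κ ℝ) (v : EuclideanSpace ℝ κ) : EuclideanSpace ℝ ι :=
  WithLp.toLp 2 (M *ᵥ v.ofLp)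

/-- Lebesgue density at `z` of the Gaussian distribution with mean `m` and (positive definite)
covariance `S`. -/
def gaussDensity (m : EuclideanSpace ℝ ι) (S : Matrix ι ι ℝ) (z : EuclideanSpace ℝ ι) : ℝ :=
  (Real.sqrt ((2 * Real.pi) ^ Fintype.card ι * S.det))⁻¹ * Real.exp (-(1 / 2) * quad S⁻¹ (z - m))

/-! In the following, `F` is the design matrix (`ι` indexes the observations and `κ` the
regression coefficients), `R` the correlation matrix of the observations, `z` the observations,
`s` the variance, `b` and `s V` the prior mean and covariance of the coefficients. -/

/-- `A` in the informative case: `[Fᵀ (R⁻¹/s) F + V⁻¹/s]⁻¹`. -/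
def covI (F : Matrix ι κ ℝ) (R : Matrix ι ι ℝ) (V : Matrix κ κ ℝ) (s : ℝ) : Matrix κ κ ℝ :=
  (Fᵀ * (s⁻¹ • R⁻¹) * F + s⁻¹ • V⁻¹)⁻¹

/-- `A` in the non-informative case: `[Fᵀ (R⁻¹/s) F]⁻¹`. -/
def covII (F : Matrix ι κ ℝ) (R : Matrix ι ι ℝ) (s : ℝ) : Matrix κ κ ℝ :=
  (Fᵀ * (s⁻¹ • R⁻¹) * F)⁻¹

/-- `ν` in the informative case: `Fᵀ (R⁻¹/s) z + (V⁻¹/s) b`. -/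
def nuI (F : Matrix ι κ ℝ) (R : Matrix ι ι ℝ) (V : Matrix κ κ ℝ) (b : EuclideanSpace ℝ κ)
    (z : EuclideanSpace ℝ ι) (s : ℝ) : EuclideanSpace ℝ κ :=
  mulE (Fᵀ * (s⁻¹ • R⁻¹)) z + mulE (s⁻¹ • V⁻¹) b

/-- `ν` in the non-informative case: `Fᵀ (R⁻¹/s) z`. -/
def nuII (F : Matrix ι κ ℝ) (R : Matrix ι ι ℝ) (z : EuclideanSpace ℝ ι) (s : ℝ) :
    EuclideanSpace ℝ κ :=
  mulE (Fᵀ * (s⁻¹ • R⁻¹)) z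

/-- The generalized least squares estimator `(Fᵀ R⁻¹ F)⁻¹ Fᵀ R⁻¹ z`. -/
def gls (F : Matrix ι κ ℝ) (R : Matrix ι ι ℝ) (z : EuclideanSpace ℝ ι) : EuclideanSpace ℝ κ :=
  mulE ((Fᵀ * R⁻¹ * F)⁻¹ * Fᵀ * R⁻¹) z

/-- `Q` in the non-informative case: `zᵀ [R⁻¹ - R⁻¹ F (Fᵀ R⁻¹ F)⁻¹ Fᵀ R⁻¹] z`. -/
def scaleII (F : Matrix ι κ ℝ) (R : Matrix ι ι ℝ) (z : EuclideanSpace ℝ ι) : ℝ :=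
  quad (R⁻¹ - R⁻¹ * F * (Fᵀ * R⁻¹ * F)⁻¹ * Fᵀ * R⁻¹) z

/-- `Q` in the informative case:
`2 γ + (b - gls)ᵀ (V + [Fᵀ R⁻¹ F]⁻¹)⁻¹ (b - gls)` plus the non-informative `Q`. -/
def scaleI (F : Matrix ι κ ℝ) (R : Matrix ι ι ℝ) (V : Matrix κ κ ℝ) (b : EuclideanSpace ℝ κ)
    (γ : ℝ) (z : EuclideanSpace ℝ ι) : ℝ :=
  2 * γ + quad (V + (Fᵀ * R⁻¹ * F)⁻¹)⁻¹ (b - gls F R z) + scaleII F R z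

end Regression

/-- The marginal likelihood of a likelihood function `L` under a (possibly improper) prior. -/
def evidence {Θ : Type*} [MeasurableSpace Θ] (prior : Measure Θ) (L : Θ → ℝ) : ℝ≥0∞ :=
  ∫⁻ θ, ENNReal.ofReal (L θ) ∂prior

/-- The posterior distribution by the Bayes formula: likelihood times (possibly improper) prior,
normalized. It is meaningful when the evidence is neither zero nor infinite. -/
def bayes {Θ : Type*} [MeasurableSpace Θ] (prior : Measure Θ) (L : Θ → ℝ) : Measure Θ :=
  (evidence prior L)⁻¹ • prior.withDensity fun θ => ENNReal.ofReal (L θ)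

/-- The Jeffreys prior `p(s) ∝ 1 / s` on the positive half line. -/
def jeffreys : Measure ℝ :=
  (volume.restrict (Set.Ioi 0)).withDensity fun s => ENNReal.ofReal (1 / s)

section Model

variable {d : ℕ} {D : Set (EuclideanSpace ℝ (Fin d))}

/-- `(x, x') ↦ r (x - x')` is a correlation function on the input domain `D`. -/
def IsCorrelation (D : Set (EuclideanSpace ℝ (Fin d))) (r : EuclideanSpace ℝ (Fin d) → ℝ) : Prop :=
  r 0 = 1 ∧ ∀ (n : ℕ) (x : Fin n → D),
    (Matrix.of fun i j => r ((x i : EuclideanSpace ℝ (Fin d)) - x j)).PosSemidef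

/-- The correlation matrix of a design. -/
def corr (r : EuclideanSpace ℝ (Fin d) → ℝ) {n : ℕ} (x : Fin n → D) : Matrix (Fin n) (Fin n) ℝ :=
  Matrix.of fun i j => r ((x i : EuclideanSpace ℝ (Fin d)) - x j)

/-- The design matrix whose rows are the regression functions at the design points. -/
def design {p : ℕ} (f : D → Fin p → ℝ) {n : ℕ} (x : Fin n → D) : Matrix (Fin n) (Fin p) ℝ :=
  Matrix.of fun i k => f (x i) k

/-- The level-two design matrix `[z₁(D₂)  F₂]`, where the `i`-th point of the second design is
the `e i`-th point of the first one. -/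
def design₂ {p n₁ n₂ : ℕ} (f₂ : D → Fin p → ℝ) (x₂ : Fin n₂ → D) (e : Fin n₂ → Fin n₁)
    (z₁ : EuclideanSpace ℝ (Fin n₁)) : Matrix (Fin n₂) (Unit ⊕ Fin p) ℝ :=
  Matrix.of fun i => Sum.elim (fun _ => z₁ (e i)) (fun k => f₂ (x₂ i) k)

/-- The values of a process at the points of a design. -/
def sample {Ω : Type*} (Z : D → Ω → ℝ) {n : ℕ} (x : Fin n → D) (ω : Ω) : EuclideanSpace ℝ (Fin n) :=
  WithLp.toLp 2 fun i => Z (x i) ω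

/-- The coefficient `ρ` of `λ = (ρ, β₂)`. -/
def rho {p : ℕ} (l : EuclideanSpace ℝ (Unit ⊕ Fin p)) : ℝ := l (Sum.inl ())

/-- The coefficient `β₂` of `λ = (ρ, β₂)`. -/
def beta₂ {p : ℕ} (l : EuclideanSpace ℝ (Unit ⊕ Fin p)) : EuclideanSpace ℝ (Fin p) :=
  WithLp.toLp 2 fun k => l (Sum.inr k)

/-- The parameters `(σ₁², β₁, σ₂², (ρ, β₂))`. -/
abbrev Param (p₁ p₂ : ℕ) : Type :=
  ℝ × EuclideanSpace ℝ (Fin p₁) × ℝ × EuclideanSpace ℝ (Unit ⊕ Fin p₂)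

/-- The law of `(Z₁(x), δ(y))` given the parameters, for finitely many points `x` and `y`, when
`Z₁` and `δ` are independent Gaussian processes with means `f₁ᵀ β₁` and `f₂ᵀ β₂` and covariance
functions `σ₁² r₁` and `σ₂² r₂`. -/
def pairLaw {p₁ p₂ : ℕ} (f₁ : D → Fin p₁ → ℝ) (f₂ : D → Fin p₂ → ℝ)
    (r₁ r₂ : EuclideanSpace ℝ (Fin d) → ℝ) {m n : ℕ} (x : Fin m → D) (y : Fin n → D)
    (θ : Param p₁ p₂) : Measure (EuclideanSpace ℝ (Fin m) × EuclideanSpace ℝ (Fin n)) :=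
  (multivariateGaussian (mulE (design f₁ x) θ.2.1) (θ.1 • corr r₁ x)).prod
    (multivariateGaussian (mulE (design f₂ y) (beta₂ θ.2.2.2)) (θ.2.2.1 • corr r₂ y))

/-- The two-level model with known parameters `θ`: under `P`, `Z₁` and `δ` are independent
Gaussian processes (with the means and covariances determined by `θ`), and `Z₂ = ρ Z₁ + δ`. -/
structure FixedModel {Ω : Type*} [MeasurableSpace Ω] (P : Measure Ω) {p₁ p₂ : ℕ}
    (f₁ : D → Fin p₁ → ℝ) (f₂ : D → Fin p₂ → ℝ) (r₁ r₂ : EuclideanSpace ℝ (Fin d) → ℝ)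
    (θ : Param p₁ p₂) (Z₁ Z₂ δ : D → Ω → ℝ) : Prop where
  measurable_Z₁ : ∀ x, Measurable (Z₁ x)
  measurable_δ : ∀ x, Measurable (δ x)
  autoregressive : ∀ x ω, Z₂ x ω = rho θ.2.2.2 * Z₁ x ω + δ x ω
  law : ∀ (m n : ℕ) (x : Fin m → D) (y : Fin n → D),
    P.map (fun ω => (sample Z₁ x ω, sample δ y ω)) = pairLaw f₁ f₂ r₁ r₂ x y θ

/-- The two-level model with random parameters `(σ₁², β₁, σ₂², (ρ, β₂)) = (s₁, β₁, s₂, l)`: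
conditionally on the parameters, `Z₁` and `δ` are independent Gaussian processes (with the means
and covariances determined by the parameters), and `Z₂ = ρ Z₁ + δ`. -/
structure RandomModel {Ω : Type*} [MeasurableSpace Ω] (P : Measure Ω) [IsFiniteMeasure P]
    {p₁ p₂ : ℕ} (f₁ : D → Fin p₁ → ℝ) (f₂ : D → Fin p₂ → ℝ)
    (r₁ r₂ : EuclideanSpace ℝ (Fin d) → ℝ)
    (s₁ : Ω → ℝ) (β₁ : Ω → EuclideanSpace ℝ (Fin p₁))
    (s₂ : Ω → ℝ) (l : Ω → EuclideanSpace ℝ (Unit ⊕ Fin p₂))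
    (Z₁ Z₂ δ : D → Ω → ℝ) : Prop where
  measurable_s₁ : Measurable s₁
  measurable_β₁ : Measurable β₁
  measurable_s₂ : Measurable s₂
  measurable_l : Measurable l
  measurable_Z₁ : ∀ x, Measurable (Z₁ x)
  measurable_δ : ∀ x, Measurable (δ x)
  autoregressive : ∀ x ω, Z₂ x ω = rho (l ω) * Z₁ x ω + δ x ω
  law : ∀ (m n : ℕ) (x : Fin m → D) (y : Fin n → D),
    condDistrib (fun ω => (sample Z₁ x ω, sample δ y ω)) (fun ω => (s₁ ω, β₁ ω, s₂ ω, l ω)) P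
      =ᵐ[P.map fun ω => (s₁ ω, β₁ ω, s₂ ω, l ω)] pairLaw f₁ f₂ r₁ r₂ x y

/-- The informative conjugate priors for the two levels, where `V₁` and `V_λ` are the diagonal
matrices with diagonals `v₁` and `vl`, and `z₁` is the sample of the first level. -/
structure InformativePriors {Ω : Type*} [MeasurableSpace Ω] (P : Measure Ω) [IsFiniteMeasure P]
    {p₁ p₂ n₁ : ℕ}
    (s₁ : Ω → ℝ) (β₁ : Ω → EuclideanSpace ℝ (Fin p₁))
    (s₂ : Ω → ℝ) (l : Ω → EuclideanSpace ℝ (Unit ⊕ Fin p₂))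
    (z₁ : Ω → EuclideanSpace ℝ (Fin n₁))
    (b₁ : EuclideanSpace ℝ (Fin p₁)) (v₁ : Fin p₁ → ℝ) (α₁ γ₁ : ℝ)
    (bl : EuclideanSpace ℝ (Unit ⊕ Fin p₂)) (vl : Unit ⊕ Fin p₂ → ℝ) (α₂ γ₂ : ℝ) : Prop where
  prior_s₁ : P.map s₁ = invGamma α₁ γ₁
  prior_β₁ : condDistrib β₁ s₁ P =ᵐ[P.map s₁]
    fun s => multivariateGaussian b₁ (s • Matrix.diagonal v₁)
  prior_s₂ : condDistrib s₂ z₁ P =ᵐ[P.map z₁] fun _ => invGamma α₂ γ₂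
  prior_l : condDistrib l (fun ω => (z₁ ω, s₂ ω)) P =ᵐ[P.map fun ω => (z₁ ω, s₂ ω)]
    fun y => multivariateGaussian bl (y.2 • Matrix.diagonal vl)

end Model

end CoKriging

end

/-! Both levels are the same Bayesian linear regression: a vector `z` drawn from N(Fβ, sR), where
`F` is deterministic at the first level and a function of `z₁` at the second. Completing the square
in β (`penalized_least_squares`) turns likelihood times Gaussian prior into a factor free of β times
the Gaussian density with mean Aν and covariance A (`likelihood_mul_prior`). The flat prior is the
case of zero penalty (`likelihood_flat`). Since A is s times a matrix free of s, and Aν is free of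
s, the leftover factor is a constant times s^(-n/2) exp(-Q/(2s)), with s^(-(n-k)/2) instead for a
flat prior on k coefficients. Multiplied by an inverse gamma density, or by 1/s, it is again
proportional to an inverse gamma density (`invGammaPDF_mul_marginal`, `jeffreys_mul_marginal`). Here
Q first appears as the least value of the (penalized) least squares criterion;
`two_mul_add_ridgeScale` and `scaleII_eq_residual` bring it to the stated form.

In the non-informative case this factorization is already the Bayes formula. An observation outside
the column space forces k < n and Q > 0, so the resulting inverse gamma distribution is proper and
the evidence is finite and positive.

In the informative case the posteriors are genuine conditional distributions. These are normalized
joint densities (`condDistrib_ae_eq_normalize`), and the joint density comes from chaining the two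
prior kernels with the likelihood (`lintegral_conjugate_joint`). That argument is carried out for a
design depending on a random `X` of arbitrary law: `X` is `z₁` at the second level and a constant at
the first. The likelihood itself comes from the autoregressive relation: given `z₁`, the vector `z₂`
is a sample of δ translated by ρ z₁(D₂) (`lintegral_pairLaw`). -/

open MeasureTheory ProbabilityTheory Matrix
open scoped ENNReal

noncomputable section

namespace CoKriging

/-! ### Lebesgue densities of nondegenerate Gaussian measures. -/

section GaussianDensity

variable {ι : Type*} [Fintype ι]

lemma ofReal_mul_ofReal_inv_mul {c : ℝ} (hc : 0 < c) (a : ℝ≥0∞) :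
    ENNReal.ofReal c * (ENNReal.ofReal c⁻¹ * a) = a := by
  rw [← mul_assoc, ← ENNReal.ofReal_mul hc.le, mul_inv_cancel₀ hc.ne', ENNReal.ofReal_one, one_mul]

lemma lintegral_withDensity_mul {α : Type*} [MeasurableSpace α] (μ : Measure α) {g f : α → ℝ≥0∞}
    (hg : Measurable g) (hf : Measurable f) :
    ∫⁻ x, f x ∂μ.withDensity g = ∫⁻ x, g x * f x ∂μ := by
  simpa using lintegral_withDensity_eq_lintegral_mul μ hg hf

/-- A product measure is determined by its values on boxes, and over a box the integral of a product
of one-variable functions factorizes. -/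
lemma pi_gaussianReal_eq_withDensity :
    Measure.pi (fun _ : ι => gaussianReal 0 1) =
      volume.withDensity fun x : ι → ℝ => ENNReal.ofReal (∏ i, gaussianPDFReal 0 1 (x i)) := by
  refine Measure.pi_eq fun s hs => ?_
  rw [withDensity_apply _ (MeasurableSet.univ_pi hs), volume_pi, Measure.restrict_pi_pi,
    ← ofReal_integral_eq_lintegral_ofReal, integral_fintype_prod_eq_prod,
    ENNReal.ofReal_prod_of_nonneg]
  · exact Finset.prod_congr rfl fun i _ => (gaussianReal_apply_eq_integral 0 one_ne_zero (s i)).symm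
  · exact fun i _ => integral_nonneg fun x => gaussianPDFReal_nonneg _ _ _
  · exact Integrable.fintype_prod fun i => (integrable_gaussianPDFReal 0 1).restrict
  · exact Filter.Eventually.of_forall fun x =>
      Finset.prod_nonneg fun i _ => gaussianPDFReal_nonneg _ _ _

lemma prod_gaussianPDFReal (x : EuclideanSpace ℝ ι) :
    ∏ i, gaussianPDFReal 0 1 (x i) =
      (Real.sqrt ((2 * Real.pi) ^ Fintype.card ι))⁻¹ * Real.exp (-(1 / 2) * ‖x‖ ^ 2) := by
  simp only [gaussianPDFReal, Finset.prod_mul_distrib, ← Real.exp_sum, Finset.prod_const,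
    Finset.card_univ, EuclideanSpace.real_norm_sq_eq, Finset.mul_sum]
  congr 1
  · rw [inv_pow]
    congr 1
    refine (Real.sqrt_eq_iff_mul_self_eq (by positivity) (by positivity)).2 ?_ |>.symm
    rw [← mul_pow, Real.mul_self_sqrt (by positivity)]
    simp
  · congr 1
    refine Finset.sum_congr rfl fun i _ => ?_
    simp
    ring

lemma stdGaussian_eq_withDensity :
    stdGaussian (EuclideanSpace ℝ ι) = volume.withDensity fun x => ENNReal.ofReal
      ((Real.sqrt ((2 * Real.pi) ^ Fintype.card ι))⁻¹ * Real.exp (-(1 / 2) * ‖x‖ ^ 2)) := by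
  rw [← map_pi_eq_stdGaussian, pi_gaussianReal_eq_withDensity]
  have hmp := PiLp.volume_preserving_toLp ι
  have hm : Measurable fun x : EuclideanSpace ℝ ι => ENNReal.ofReal
      ((Real.sqrt ((2 * Real.pi) ^ Fintype.card ι))⁻¹ * Real.exp (-(1 / 2) * ‖x‖ ^ 2)) := by
    fun_prop
  refine Measure.ext_of_lintegral _ fun f hf => ?_
  rw [lintegral_map hf hmp.measurable, lintegral_withDensity_mul _ (by fun_prop)
    (by fun_prop), lintegral_withDensity_mul _ hm hf, ← hmp.lintegral_comp (hm.fun_mul hf)]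
  refine lintegral_congr fun x => ?_
  rw [← prod_gaussianPDFReal]

/-- Affine change of variables: a linear map scales Lebesgue measure by the inverse of its
determinant, and translations preserve it. -/
lemma lintegral_comp_add_toEuclideanCLM [DecidableEq ι] (m : EuclideanSpace ℝ ι) {T : Matrix ι ι ℝ} (hT : 0 < T.det)
    {f : EuclideanSpace ℝ ι → ℝ≥0∞} (hf : Measurable f) :
    ∫⁻ x, f (m + toEuclideanCLM (𝕜 := ℝ) T x) = ENNReal.ofReal T.det⁻¹ * ∫⁻ x, f x := by
  have hdet : LinearMap.det (toEuclideanLin (𝕜 := ℝ) T) = T.det := by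
    rw [Matrix.toEuclideanLin_eq_toLin_orthonormal, LinearMap.det_toLin]
  have hne : LinearMap.det (toEuclideanLin (𝕜 := ℝ) T) ≠ 0 := by rw [hdet]; exact hT.ne'
  have hmap := Measure.map_linearMap_addHaar_eq_smul_addHaar
    (volume : Measure (EuclideanSpace ℝ ι)) hne
  rw [hdet, abs_of_pos (inv_pos.2 hT)] at hmap
  have hmeas : Measurable (toEuclideanLin (𝕜 := ℝ) T) :=
    (toEuclideanCLM (𝕜 := ℝ) T).continuous.measurable
  calc ∫⁻ x, f (m + toEuclideanCLM (𝕜 := ℝ) T x)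
      = ∫⁻ x, (fun y => f (m + y)) (toEuclideanLin (𝕜 := ℝ) T x) := rfl
    _ = ∫⁻ y, f (m + y) ∂(volume.map (toEuclideanLin (𝕜 := ℝ) T)) :=
        (lintegral_map (f := fun y => f (m + y)) (by fun_prop) hmeas).symm
    _ = ENNReal.ofReal T.det⁻¹ * ∫⁻ x, f x := by
        rw [hmap, lintegral_smul_measure, lintegral_add_left_eq_self, smul_eq_mul]

lemma measurable_gaussDensity [DecidableEq ι] (m : EuclideanSpace ℝ ι) (S : Matrix ι ι ℝ) :
    Measurable (gaussDensity m S) := by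
  unfold gaussDensity quad
  simp only [dotProduct, mulVec]
  fun_prop

open scoped MatrixOrder in
/-- A nondegenerate Gaussian distribution has the Gaussian density. -/
theorem multivariateGaussian_eq_withDensity [DecidableEq ι] (m : EuclideanSpace ℝ ι) {S : Matrix ι ι ℝ}
    (hS : S.PosDef) :
    multivariateGaussian m S =
      volume.withDensity fun x => ENNReal.ofReal (gaussDensity m S x) := by
  set T : Matrix ι ι ℝ := CFC.sqrt S with hTdef
  have hTT : T * T = S := CFC.sqrt_mul_sqrt_self _ hS.posSemidef.nonneg
  have hTherm : Tᵀ = T := by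
    have := (CFC.sqrt_nonneg S).isSelfAdjoint
    rw [IsSelfAdjoint, star_eq_conjTranspose, conjTranspose_eq_transpose_of_trivial] at this
    exact this
  have hTdet : T.det = Real.sqrt S.det := by
    rw [hTdef, hS.posSemidef.det_sqrt, RCLike.sqrt_of_nonneg hS.det_pos.le]
    rfl
  have hTpos : 0 < T.det := by
    rw [hTdet]
    exact Real.sqrt_pos.2 hS.det_pos
  have hunit : IsUnit T.det := hTpos.ne'.isUnit
  -- The symmetric root satisfies T S⁻¹ T = 1, so x ↦ m + T x carries the quadratic form of `S⁻¹` to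
  -- the squared norm.
  have hquad (x : EuclideanSpace ℝ ι) :
      quad S⁻¹ (m + toEuclideanCLM (𝕜 := ℝ) T x - m) = ‖x‖ ^ 2 := by
    rw [add_sub_cancel_left, quad, ofLp_toEuclideanCLM, ← hTT, Matrix.mul_inv_rev,
      mulVec_mulVec, Matrix.mul_assoc, nonsing_inv_mul _ hunit, Matrix.mul_one, dotProduct_mulVec,
      ← mulVec_transpose, transpose_nonsing_inv, hTherm, mulVec_mulVec,
      nonsing_inv_mul _ hunit, one_mulVec, EuclideanSpace.real_norm_sq_eq]
    simp [dotProduct, sq]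
  have hgm := (measurable_gaussDensity m S).ennreal_ofReal
  refine Measure.ext_of_lintegral _ fun f hf => ?_
  rw [multivariateGaussian, lintegral_map hf (by fun_prop), stdGaussian_eq_withDensity,
    lintegral_withDensity_mul _ (by fun_prop) (by fun_prop), lintegral_withDensity_mul _ hgm hf]
  -- The factor det T · (det T)⁻¹ is inserted so that its second half is the Jacobian; the first
  -- half then cancels the root of det S in the density.
  rw [← ofReal_mul_ofReal_inv_mul hTpos (∫⁻ a, ENNReal.ofReal (gaussDensity m S a) * f a),
    ← lintegral_comp_add_toEuclideanCLM m hTpos (hgm.fun_mul hf),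
    ← lintegral_const_mul' _ _ ENNReal.ofReal_ne_top]
  refine lintegral_congr fun x => ?_
  rw [← mul_assoc, ← ENNReal.ofReal_mul hTpos.le, gaussDensity, hquad, hTdet,
    Real.sqrt_mul (by positivity), mul_inv]
  congr 2
  field_simp [(Real.sqrt_pos.2 hS.det_pos).ne']

end GaussianDensity


/-! ### Quadratic forms and completion of the square. -/

section Algebra

variable {ι κ : Type*} [Fintype ι] [Fintype κ]

lemma quad_expand_sub {M : Matrix ι ι ℝ} (hM : Mᵀ = M) (a c : ι → ℝ) :
    (a - c) ⬝ᵥ (M *ᵥ (a - c)) = a ⬝ᵥ (M *ᵥ a) - 2 * (c ⬝ᵥ (M *ᵥ a)) + c ⬝ᵥ (M *ᵥ c) := by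
  have h : a ⬝ᵥ (M *ᵥ c) = c ⬝ᵥ (M *ᵥ a) := by
    rw [dotProduct_mulVec, ← mulVec_transpose, hM, dotProduct_comm]
  rw [mulVec_sub, sub_dotProduct, dotProduct_sub, dotProduct_sub, h]
  ring

lemma mulVec_dotProduct_mulVec (F : Matrix ι κ ℝ) (v : κ → ℝ) (w : ι → ℝ) :
    (F *ᵥ v) ⬝ᵥ w = v ⬝ᵥ (Fᵀ *ᵥ w) := by
  rw [dotProduct_comm, dotProduct_mulVec, ← mulVec_transpose, dotProduct_comm]

/-- Completion of the square in a penalized least squares criterion. -/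
lemma penalized_least_squares {F : Matrix ι κ ℝ} {S : Matrix ι ι ℝ} {W : Matrix κ κ ℝ}
    (hS : Sᵀ = S) (hW : Wᵀ = W) (z : ι → ℝ) (b m β : κ → ℝ)
    (hm : (Fᵀ * S * F + W) *ᵥ m = Fᵀ *ᵥ (S *ᵥ z) + W *ᵥ b) :
    (z - F *ᵥ β) ⬝ᵥ (S *ᵥ (z - F *ᵥ β)) + (β - b) ⬝ᵥ (W *ᵥ (β - b)) =
      (β - m) ⬝ᵥ ((Fᵀ * S * F + W) *ᵥ (β - m)) +
        ((z - F *ᵥ m) ⬝ᵥ (S *ᵥ (z - F *ᵥ m)) + (m - b) ⬝ᵥ (W *ᵥ (m - b))) := by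
  have h1 : z - F *ᵥ β = (z - F *ᵥ m) - F *ᵥ (β - m) := by rw [mulVec_sub]; abel
  have h2 : β - b = (m - b) - (m - β) := by abel
  have h3 : m - β = -(β - m) := by abel
  -- The normal equation as stationarity of the criterion at `m`: it makes the two terms linear in β
  -- - m cancel.
  have h4 : Fᵀ *ᵥ (S *ᵥ (z - F *ᵥ m)) = W *ᵥ (m - b) := by
    rw [add_mulVec, ← mulVec_mulVec, ← mulVec_mulVec] at hm
    rw [mulVec_sub, mulVec_sub, mulVec_sub, sub_eq_sub_iff_add_eq_add]
    rw [add_comm (W *ᵥ m), ← hm]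
  rw [h1, h2, quad_expand_sub hS, quad_expand_sub hW, mulVec_dotProduct_mulVec, h4,
    mulVec_dotProduct_mulVec, h3, add_mulVec, dotProduct_add, ← mulVec_mulVec, ← mulVec_mulVec]
  simp only [mulVec_neg, neg_dotProduct, dotProduct_neg, neg_neg]
  ring

lemma transpose_eq_of_posDef {ν : Type*} {M : Matrix ν ν ℝ} (hM : M.PosDef) : Mᵀ = M := by
  simpa [conjTranspose_eq_transpose_of_trivial] using hM.isHermitian.eq

lemma posDef_gram [DecidableEq ι] {F : Matrix ι κ ℝ} {R : Matrix ι ι ℝ} (hR : R.PosDef)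
    (hF : LinearIndependent ℝ F.col) : (Fᵀ * R⁻¹ * F).PosDef := by
  have := hR.inv.conjTranspose_mul_mul_same (mulVec_injective_iff.2 hF)
  rwa [conjTranspose_eq_transpose_of_trivial] at this

lemma quad_nonneg {M : Matrix ι ι ℝ} (hM : M.PosSemidef) (v : EuclideanSpace ℝ ι) :
    0 ≤ quad M v := by
  simpa [quad] using hM.dotProduct_mulVec_nonneg v.ofLp

lemma quad_pos {M : Matrix ι ι ℝ} (hM : M.PosDef) {v : EuclideanSpace ℝ ι} (hv : v ≠ 0) :
    0 < quad M v := by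
  simpa [quad] using hM.dotProduct_mulVec_pos (x := v.ofLp) (by simpa using hv)

end Algebra

/-! ### Generalized least squares and the scale parameters Q. -/

section Regression

variable {ι κ : Type*} [Fintype ι] [DecidableEq ι] [Fintype κ] [DecidableEq κ]

lemma posDef_gram_add {F : Matrix ι κ ℝ} {R : Matrix ι ι ℝ} {V : Matrix κ κ ℝ} (hR : R.PosDef)
    (hV : V.PosDef) : (Fᵀ * R⁻¹ * F + V⁻¹).PosDef := by
  have := hR.inv.posSemidef.conjTranspose_mul_mul_same F
  rw [conjTranspose_eq_transpose_of_trivial] at this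
  exact Matrix.PosDef.posSemidef_add this hV.inv

lemma inv_smul_matrix (R : Matrix ι ι ℝ) (hR : IsUnit R.det) {s : ℝ} (hs : s ≠ 0) :
    (s • R)⁻¹ = s⁻¹ • R⁻¹ := by
  have := Matrix.inv_smul' R (Units.mk0 s hs) hR
  exact this

lemma gls_normal_equation {F : Matrix ι κ ℝ} {R : Matrix ι ι ℝ} (hR : R.PosDef)
    (hF : LinearIndependent ℝ F.col) (z : EuclideanSpace ℝ ι) :
    (Fᵀ * R⁻¹ * F) *ᵥ (gls F R z).ofLp = Fᵀ *ᵥ (R⁻¹ *ᵥ z.ofLp) := by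
  have hM := (posDef_gram hR hF).det_pos.ne'.isUnit
  rw [gls, mulE, mulVec_mulVec, Matrix.mul_assoc (Fᵀ * R⁻¹ * F)⁻¹, ← Matrix.mul_assoc,
    mul_nonsing_inv _ hM, Matrix.one_mul, mulVec_mulVec]

/-- Expanding the residual, the normal equation makes the fitted square equal to the cross term, so
one copy of it is left with a minus sign. As a residual, Q is visibly positive when `z` is outside
the column space. -/
lemma scaleII_eq_residual {F : Matrix ι κ ℝ} {R : Matrix ι ι ℝ} (hR : R.PosDef)
    (hF : LinearIndependent ℝ F.col) (z : EuclideanSpace ℝ ι) :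
    scaleII F R z = quad R⁻¹ (z - mulE F (gls F R z)) := by
  have hS := transpose_eq_of_posDef hR.inv
  have hn := gls_normal_equation hR hF z
  rw [← mulVec_mulVec, ← mulVec_mulVec] at hn
  have hg : R⁻¹ *ᵥ (F *ᵥ (gls F R z).ofLp) =
      (R⁻¹ * F * (Fᵀ * R⁻¹ * F)⁻¹ * Fᵀ * R⁻¹) *ᵥ z.ofLp := by
    simp only [gls, mulE, mulVec_mulVec, Matrix.mul_assoc]
  simp only [quad, mulE, WithLp.ofLp_sub, scaleII]
  rw [quad_expand_sub hS, mulVec_dotProduct_mulVec, mulVec_dotProduct_mulVec, hn, sub_mulVec,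
    dotProduct_sub, ← hg]
  have : z.ofLp ⬝ᵥ R⁻¹ *ᵥ F *ᵥ (gls F R z).ofLp =
      (gls F R z).ofLp ⬝ᵥ Fᵀ *ᵥ R⁻¹ *ᵥ z.ofLp := by
    rw [← mulVec_dotProduct_mulVec, dotProduct_mulVec, ← mulVec_transpose, hS, dotProduct_comm]
  rw [this]
  ring

/-- The penalized least squares criterion at `m`. -/
def ridgeScale (F : Matrix ι κ ℝ) (R : Matrix ι ι ℝ) (W : Matrix κ κ ℝ)
    (b : EuclideanSpace ℝ κ) (z : EuclideanSpace ℝ ι) (m : EuclideanSpace ℝ κ) : ℝ :=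
  quad R⁻¹ (z - mulE F m) + quad W (m - b)

/-- The ridge estimator `(Fᵀ R⁻¹ F + W)⁻¹ (Fᵀ R⁻¹ z + W b)` of the coefficients. -/
def ridge (F : Matrix ι κ ℝ) (R : Matrix ι ι ℝ) (W : Matrix κ κ ℝ) (b : EuclideanSpace ℝ κ)
    (z : EuclideanSpace ℝ ι) : EuclideanSpace ℝ κ :=
  mulE (Fᵀ * R⁻¹ * F + W)⁻¹ (mulE (Fᵀ * R⁻¹) z + mulE W b)

lemma ridge_normal_equation {F : Matrix ι κ ℝ} {R : Matrix ι ι ℝ} {W : Matrix κ κ ℝ}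
    (hH : (Fᵀ * R⁻¹ * F + W).PosDef) (b : EuclideanSpace ℝ κ) (z : EuclideanSpace ℝ ι) :
    (Fᵀ * R⁻¹ * F + W) *ᵥ (ridge F R W b z).ofLp = Fᵀ *ᵥ (R⁻¹ *ᵥ z.ofLp) + W *ᵥ b.ofLp := by
  simp only [ridge, mulE, WithLp.ofLp_add, mulVec_mulVec]
  rw [mul_nonsing_inv _ hH.det_pos.ne'.isUnit, one_mulVec]

lemma ridge_zero (F : Matrix ι κ ℝ) (R : Matrix ι ι ℝ) (b : EuclideanSpace ℝ κ)
    (z : EuclideanSpace ℝ ι) : ridge F R 0 b z = gls F R z := by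
  simp [ridge, gls, mulE, Matrix.mul_assoc]

/-- The penalty `W` need not be invertible, only the sum with the Gram matrix must be positive
definite: W = V⁻¹ serves the Gaussian prior and W = 0 the flat one. -/
lemma quad_add_quad_eq_ridge {F : Matrix ι κ ℝ} {R : Matrix ι ι ℝ} {W : Matrix κ κ ℝ}
    (hR : R.PosDef) (hW : Wᵀ = W) (hH : (Fᵀ * R⁻¹ * F + W).PosDef)
    (b : EuclideanSpace ℝ κ) (z : EuclideanSpace ℝ ι) (β : EuclideanSpace ℝ κ) :
    quad R⁻¹ (z - mulE F β) + quad W (β - b) =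
      quad (Fᵀ * R⁻¹ * F + W) (β - ridge F R W b z) +
        ridgeScale F R W b z (ridge F R W b z) :=
  penalized_least_squares (transpose_eq_of_posDef hR.inv) hW z.ofLp b.ofLp _ β.ofLp
    (ridge_normal_equation hH b z)

lemma ridgeScale_zero {F : Matrix ι κ ℝ} {R : Matrix ι ι ℝ} (hR : R.PosDef)
    (hF : LinearIndependent ℝ F.col) (b : EuclideanSpace ℝ κ) (z : EuclideanSpace ℝ ι) :
    ridgeScale F R 0 b z (ridge F R 0 b z) = scaleII F R z := by
  rw [ridge_zero, scaleII_eq_residual hR hF, ridgeScale]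
  simp [quad]

/-- With M the Gram matrix and g the least squares estimator, the vector y solving (V + M⁻¹) y = b -
g parametrizes everything without a matrix inversion identity. The ridge estimator is g + M⁻¹ y, so
it differs from g by M⁻¹ y and from b by -V y. The excess residual is then yᵀ M⁻¹ y, the penalty is
yᵀ V y, and they add up to the quadratic form of (V + M⁻¹)⁻¹ at b - g. -/
lemma two_mul_add_ridgeScale {F : Matrix ι κ ℝ} {R : Matrix ι ι ℝ} {V : Matrix κ κ ℝ}
    (hR : R.PosDef) (hV : V.PosDef) (hF : LinearIndependent ℝ F.col)
    (b : EuclideanSpace ℝ κ) (γ : ℝ) (z : EuclideanSpace ℝ ι) :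
    2 * γ + ridgeScale F R V⁻¹ b z (ridge F R V⁻¹ b z) = scaleI F R V b γ z := by
  set M := Fᵀ * R⁻¹ * F with hMdef
  have hM : M.PosDef := posDef_gram hR hF
  have hH : (M + V⁻¹).PosDef := posDef_gram_add hR hV
  have hK : (V + M⁻¹).PosDef := hV.add hM.inv
  set g := (gls F R z).ofLp with hg
  set y := (V + M⁻¹)⁻¹ *ᵥ (b.ofLp - g) with hy
  have hMg : M *ᵥ g = Fᵀ *ᵥ (R⁻¹ *ᵥ z.ofLp) := gls_normal_equation hR hF z
  have hyK : V *ᵥ y + M⁻¹ *ᵥ y = b.ofLp - g := by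
    rw [← add_mulVec, hy, mulVec_mulVec, mul_nonsing_inv _ hK.det_pos.ne'.isUnit, one_mulVec]
  have hMM : M *ᵥ (M⁻¹ *ᵥ y) = y := by
    rw [mulVec_mulVec, mul_nonsing_inv _ hM.det_pos.ne'.isUnit, one_mulVec]
  have hVV : V⁻¹ *ᵥ (V *ᵥ y) = y := by
    rw [mulVec_mulVec, nonsing_inv_mul _ hV.det_pos.ne'.isUnit, one_mulVec]
  have hb : b.ofLp = g + M⁻¹ *ᵥ y + V *ᵥ y := by
    rw [eq_sub_iff_add_eq] at hyK
    rw [← hyK]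
    abel
  have hm : (ridge F R V⁻¹ b z).ofLp = g + M⁻¹ *ᵥ y := by
    have hinj := mulVec_injective_of_isUnit
      ((Matrix.isUnit_iff_isUnit_det _).2 hH.det_pos.ne'.isUnit)
    apply hinj
    change (M + V⁻¹) *ᵥ _ = (M + V⁻¹) *ᵥ _
    rw [ridge_normal_equation hH b z, ← hMg, add_mulVec, hb]
    simp only [mulVec_add, hMM, hVV]
    abel
  -- The unpenalized square, evaluated at the ridge estimator, compares its residual with the
  -- minimal one.
  have h2 := quad_add_quad_eq_ridge (W := 0) hR transpose_zero (by simpa using hM) b z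
    (ridge F R V⁻¹ b z)
  rw [ridgeScale_zero hR hF, ridge_zero] at h2
  have h3 : quad (Fᵀ * R⁻¹ * F + 0) (ridge F R V⁻¹ b z - gls F R z) = y ⬝ᵥ (M⁻¹ *ᵥ y) := by
    rw [add_zero, quad, WithLp.ofLp_sub, hm, ← hg, add_sub_cancel_left, ← hMdef, hMM,
      dotProduct_comm]
  have h4 : quad V⁻¹ (ridge F R V⁻¹ b z - b) = y ⬝ᵥ (V *ᵥ y) := by
    rw [quad, WithLp.ofLp_sub, hm, hb, sub_add_cancel_left, mulVec_neg, hVV, neg_dotProduct_neg,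
      dotProduct_comm]
  have h5 : quad (V + M⁻¹)⁻¹ (b - gls F R z) = y ⬝ᵥ (V *ᵥ y) + y ⬝ᵥ (M⁻¹ *ᵥ y) := by
    rw [quad, WithLp.ofLp_sub, ← hg, ← hy, ← hyK, add_dotProduct, dotProduct_comm,
      dotProduct_comm y (M⁻¹ *ᵥ y), add_comm]
  have h6 : quad (0 : Matrix κ κ ℝ) (ridge F R V⁻¹ b z - b) = 0 := by simp [quad]
  rw [h3, h6] at h2
  rw [ridgeScale, scaleI, ← hMdef, h5, h4]
  linarith

end Regression


/-! ### Pointwise factorization of likelihood times prior. -/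

section Conjugacy

variable {ι κ : Type*} [Fintype ι] [DecidableEq ι] [Fintype κ] [DecidableEq κ]

/-- The factor of the Gaussian density with covariance `s • R` that depends neither on `s` nor on
the observations. -/
def gaussConst (R : Matrix ι ι ℝ) : ℝ := (Real.sqrt ((2 * Real.pi) ^ Fintype.card ι * R.det))⁻¹

lemma gaussConst_pos {R : Matrix ι ι ℝ} (hR : R.PosDef) : 0 < gaussConst R := by
  have := hR.det_pos
  unfold gaussConst
  positivity

/-- Isolates the dependence on the variance, which is what the inverse gamma computations consume.
-/
lemma gaussDensity_smul {R : Matrix ι ι ℝ} (hR : R.PosDef) {s : ℝ} (hs : 0 < s)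
    (m z : EuclideanSpace ℝ ι) :
    gaussDensity m (s • R) z = gaussConst R * (Real.sqrt s ^ Fintype.card ι)⁻¹ *
      Real.exp (-(quad R⁻¹ (z - m) / 2 / s)) := by
  have hsq : Real.sqrt (s ^ Fintype.card ι) = Real.sqrt s ^ Fintype.card ι := by
    rw [Real.sqrt_eq_iff_mul_self_eq (by positivity) (by positivity), ← mul_pow,
      Real.mul_self_sqrt hs.le]
  have hq : quad (s⁻¹ • R⁻¹) (z - m) = s⁻¹ * quad R⁻¹ (z - m) := by
    simp [quad, smul_mulVec, dotProduct_smul]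
  rw [gaussDensity, gaussConst, inv_smul_matrix R hR.det_pos.ne'.isUnit hs.ne', hq, det_smul,
    mul_left_comm, Real.sqrt_mul (by positivity), hsq, mul_inv]
  congr 1
  · ring
  · congr 1
    field_simp

lemma gaussDensity_nonneg (m : EuclideanSpace ℝ ι) (S : Matrix ι ι ℝ) (z : EuclideanSpace ℝ ι) :
    0 ≤ gaussDensity m S z := by
  unfold gaussDensity
  positivity

lemma covI_eq_smul {F : Matrix ι κ ℝ} {R : Matrix ι ι ℝ} {V : Matrix κ κ ℝ} (hR : R.PosDef)
    (hV : V.PosDef) {s : ℝ} (hs : 0 < s) :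
    covI F R V s = s • (Fᵀ * R⁻¹ * F + V⁻¹)⁻¹ := by
  rw [covI, Matrix.mul_smul, Matrix.smul_mul, ← smul_add,
    inv_smul_matrix _ (posDef_gram_add hR hV).det_pos.ne'.isUnit (inv_ne_zero hs.ne'), inv_inv]

lemma covII_eq_smul {F : Matrix ι κ ℝ} {R : Matrix ι ι ℝ} (hR : R.PosDef)
    (hF : LinearIndependent ℝ F.col) {s : ℝ} (hs : 0 < s) :
    covII F R s = s • (Fᵀ * R⁻¹ * F)⁻¹ := by
  rw [covII, Matrix.mul_smul, Matrix.smul_mul,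
    inv_smul_matrix _ (posDef_gram hR hF).det_pos.ne'.isUnit (inv_ne_zero hs.ne'), inv_inv]

lemma mulE_covI_nuI {F : Matrix ι κ ℝ} {R : Matrix ι ι ℝ} {V : Matrix κ κ ℝ} (hR : R.PosDef)
    (hV : V.PosDef) {s : ℝ} (hs : 0 < s) (b : EuclideanSpace ℝ κ) (z : EuclideanSpace ℝ ι) :
    mulE (covI F R V s) (nuI F R V b z s) = ridge F R V⁻¹ b z := by
  rw [covI_eq_smul hR hV hs, nuI, ridge]
  simp only [mulE, Matrix.mul_smul, smul_mulVec, WithLp.ofLp_add, ← smul_add, mulVec_smul,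
    smul_smul, inv_mul_cancel₀ hs.ne', one_smul]

lemma mulE_covII_nuII {F : Matrix ι κ ℝ} {R : Matrix ι ι ℝ} (hR : R.PosDef)
    (hF : LinearIndependent ℝ F.col) {s : ℝ} (hs : 0 < s) (z : EuclideanSpace ℝ ι) :
    mulE (covII F R s) (nuII F R z s) = gls F R z := by
  rw [covII_eq_smul hR hF hs, nuII, gls]
  simp only [mulE, Matrix.mul_smul, Matrix.smul_mul, smul_mulVec, mulVec_smul, mulVec_mulVec,
    smul_smul, inv_mul_cancel₀ hs.ne', one_smul, Matrix.mul_assoc]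

lemma gaussDensity_ridge {H : Matrix κ κ ℝ} (hH : H.PosDef) {s : ℝ} (hs : 0 < s)
    (m β : EuclideanSpace ℝ κ) :
    gaussDensity m (s • H⁻¹) β = gaussConst H⁻¹ * (Real.sqrt s ^ Fintype.card κ)⁻¹ *
      Real.exp (-(quad H (β - m) / 2 / s)) := by
  rw [gaussDensity_smul hH.inv hs, nonsing_inv_nonsing_inv _ hH.det_pos.ne'.isUnit]

/-- Likelihood times conjugate prior, as marginal likelihood times posterior. -/
lemma likelihood_mul_prior {F : Matrix ι κ ℝ} {R : Matrix ι ι ℝ} {V : Matrix κ κ ℝ}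
    (hR : R.PosDef) (hV : V.PosDef) (b : EuclideanSpace ℝ κ) (z : EuclideanSpace ℝ ι) {s : ℝ}
    (hs : 0 < s) (β : EuclideanSpace ℝ κ) :
    gaussDensity b (s • V) β * gaussDensity (mulE F β) (s • R) z =
      gaussConst R * gaussConst V * (gaussConst (Fᵀ * R⁻¹ * F + V⁻¹)⁻¹)⁻¹ *
          (Real.sqrt s ^ Fintype.card ι)⁻¹ *
          Real.exp (-(ridgeScale F R V⁻¹ b z (ridge F R V⁻¹ b z) / 2 / s)) *
        gaussDensity (mulE (covI F R V s) (nuI F R V b z s)) (covI F R V s) β := by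
  have hH : (Fᵀ * R⁻¹ * F + V⁻¹).PosDef := posDef_gram_add hR hV
  have hc := (gaussConst_pos hH.inv).ne'
  rw [mulE_covI_nuI hR hV hs, covI_eq_smul hR hV hs, gaussDensity_ridge hH hs,
    gaussDensity_smul hR hs, gaussDensity_smul hV hs]
  have key := quad_add_quad_eq_ridge hR (transpose_eq_of_posDef hV.inv) hH b z β
  have hexp : Real.exp (-(quad V⁻¹ (β - b) / 2 / s)) *
        Real.exp (-(quad R⁻¹ (z - mulE F β) / 2 / s)) =
      Real.exp (-(ridgeScale F R V⁻¹ b z (ridge F R V⁻¹ b z) / 2 / s)) *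
        Real.exp (-(quad (Fᵀ * R⁻¹ * F + V⁻¹) (β - ridge F R V⁻¹ b z) / 2 / s)) := by
    rw [← Real.exp_add, ← Real.exp_add, ← neg_add, ← neg_add, ← add_div, ← add_div, ← add_div,
      ← add_div, add_comm (quad V⁻¹ (β - b)), key, add_comm]
  calc _ = gaussConst R * gaussConst V * (Real.sqrt s ^ Fintype.card ι)⁻¹ *
        (Real.sqrt s ^ Fintype.card κ)⁻¹ * (Real.exp (-(quad V⁻¹ (β - b) / 2 / s)) *
        Real.exp (-(quad R⁻¹ (z - mulE F β) / 2 / s))) := by ring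
    _ = _ := by
      rw [hexp]
      field_simp

/-- The likelihood as marginal likelihood under the flat prior times posterior. -/
lemma likelihood_flat {F : Matrix ι κ ℝ} {R : Matrix ι ι ℝ}
    (hR : R.PosDef) (hF : LinearIndependent ℝ F.col) (z : EuclideanSpace ℝ ι) {s : ℝ}
    (hs : 0 < s) (β : EuclideanSpace ℝ κ) :
    gaussDensity (mulE F β) (s • R) z =
      gaussConst R * (gaussConst (Fᵀ * R⁻¹ * F)⁻¹)⁻¹ *
          (Real.sqrt s ^ Fintype.card κ * (Real.sqrt s ^ Fintype.card ι)⁻¹) *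
          Real.exp (-(scaleII F R z / 2 / s)) *
        gaussDensity (mulE (covII F R s) (nuII F R z s)) (covII F R s) β := by
  have hH : (Fᵀ * R⁻¹ * F).PosDef := posDef_gram hR hF
  have hc := (gaussConst_pos hH.inv).ne'
  rw [mulE_covII_nuII hR hF hs, covII_eq_smul hR hF hs, gaussDensity_ridge hH hs,
    gaussDensity_smul hR hs]
  -- With zero penalty the prior mean is immaterial; 0 is an arbitrary choice.
  have key := quad_add_quad_eq_ridge (W := 0) hR transpose_zero (by simpa using hH) 0 z β
  rw [ridgeScale_zero hR hF, ridge_zero, add_zero] at key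
  have h0 : quad (0 : Matrix κ κ ℝ) (β - 0) = 0 := by simp [quad]
  rw [h0, add_zero] at key
  have hpos : 0 < Real.sqrt s := Real.sqrt_pos.2 hs
  rw [key, add_div, add_div, neg_add, Real.exp_add]
  field_simp

lemma posDef_covI {F : Matrix ι κ ℝ} {R : Matrix ι ι ℝ} {V : Matrix κ κ ℝ} (hR : R.PosDef)
    (hV : V.PosDef) {s : ℝ} (hs : 0 < s) : (covI F R V s).PosDef := by
  rw [covI_eq_smul hR hV hs]
  exact (posDef_gram_add hR hV).inv.smul hs

lemma posDef_covII {F : Matrix ι κ ℝ} {R : Matrix ι ι ℝ} (hR : R.PosDef)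
    (hF : LinearIndependent ℝ F.col) {s : ℝ} (hs : 0 < s) : (covII F R s).PosDef := by
  rw [covII_eq_smul hR hF hs]
  exact (posDef_gram hR hF).inv.smul hs

end Conjugacy

/-! ### The inverse gamma distribution and its conjugacy. -/

section InverseGamma

lemma measurable_invGammaPDF (α q : ℝ) : Measurable (invGammaPDF α q) := by
  unfold invGammaPDF
  refine Measurable.ite measurableSet_Ioi ?_ measurable_const
  fun_prop

lemma invGammaPDF_nonneg {α q : ℝ} (hα : 0 < α) (hq : 0 < q) (x : ℝ) :
    0 ≤ invGammaPDF α q x := by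
  have := Real.Gamma_pos_of_pos hα
  unfold invGammaPDF
  split_ifs <;> positivity

lemma invGammaPDF_of_nonpos {α q x : ℝ} (hx : x ≤ 0) : invGammaPDF α q x = 0 :=
  if_neg hx.not_gt

/-- The substitution x ↦ x⁻¹ on the positive half line turns the gamma density, of total mass 1,
into this one. -/
lemma lintegral_invGammaPDF {α q : ℝ} (hα : 0 < α) (hq : 0 < q) :
    ∫⁻ x, ENNReal.ofReal (invGammaPDF α q x) = 1 := by
  have hG := Real.Gamma_pos_of_pos hα
  have himage : (fun x : ℝ => x⁻¹) '' Set.Ioi 0 = Set.Ioi 0 := by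
    ext x
    refine ⟨?_, fun hx => ⟨x⁻¹, Set.mem_Ioi.2 (inv_pos.2 hx), inv_inv x⟩⟩
    rintro ⟨y, hy, rfl⟩
    exact Set.mem_Ioi.2 (inv_pos.2 (Set.mem_Ioi.1 hy))
  have hcv := lintegral_image_eq_lintegral_abs_deriv_mul (s := Set.Ioi (0 : ℝ))
    (f := fun x => x⁻¹) (f' := fun x => -(x ^ 2)⁻¹) measurableSet_Ioi
    (fun x hx => (hasDerivAt_inv (ne_of_gt hx)).hasDerivWithinAt) inv_injective.injOn
    (gammaPDF α q)
  rw [himage] at hcv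
  have h1 : ∫⁻ x in Set.Ioi (0 : ℝ), gammaPDF α q x = 1 := by
    have h := lintegral_add_compl (μ := volume) (gammaPDF α q) (measurableSet_Ioi (a := (0 : ℝ)))
    rwa [lintegral_gammaPDF_eq_one hα hq, Set.compl_Ioi,
      Measure.restrict_congr_set Iio_ae_eq_Iic.symm, lintegral_gammaPDF_of_nonpos le_rfl,
      add_zero] at h
  have h2 : ∫⁻ x, ENNReal.ofReal (invGammaPDF α q x) =
      ∫⁻ x in Set.Ioi (0 : ℝ), ENNReal.ofReal (invGammaPDF α q x) := by
    rw [← lintegral_indicator measurableSet_Ioi]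
    refine lintegral_congr fun x => ?_
    by_cases hx : 0 < x
    · rw [Set.indicator_of_mem (Set.mem_Ioi.2 hx)]
    · rw [Set.indicator_of_notMem (by simpa using hx), invGammaPDF_of_nonpos (not_lt.1 hx),
        ENNReal.ofReal_zero]
  rw [h2, ← h1, hcv]
  refine setLIntegral_congr_fun measurableSet_Ioi fun x hx => ?_
  have hx : 0 < x := hx
  rw [gammaPDF, gammaPDFReal, if_pos (inv_pos.2 hx).le, ← ENNReal.ofReal_mul (abs_nonneg _),
    abs_neg, abs_of_pos (by positivity), invGammaPDF, if_pos hx, Real.inv_rpow hx.le,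
    Real.rpow_add hx, Real.rpow_sub hx, Real.rpow_one]
  congr 1
  have : 0 < x ^ α := Real.rpow_pos_of_pos hx α
  rw [div_eq_mul_inv q x]
  field_simp

lemma isProbabilityMeasure_invGamma {α q : ℝ} (hα : 0 < α) (hq : 0 < q) :
    IsProbabilityMeasure (invGamma α q) :=
  ⟨by rw [invGamma, withDensity_apply _ MeasurableSet.univ, Measure.restrict_univ,
    lintegral_invGammaPDF hα hq]⟩

lemma sqrt_pow_eq_rpow {s : ℝ} (n : ℕ) (hs : 0 ≤ s) : Real.sqrt s ^ n = s ^ ((n : ℝ) / 2) := by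
  rw [Real.sqrt_eq_rpow, ← Real.rpow_natCast, ← Real.rpow_mul hs]
  congr 1
  ring

lemma invGammaPDF_eq_of_pos {α q s : ℝ} (hs : 0 < s) :
    invGammaPDF α q s = q ^ α / Real.Gamma α * (Real.exp (-(q / s)) / (s ^ α * s)) := by
  rw [invGammaPDF, if_pos hs, Real.rpow_add hs, Real.rpow_one]

/-- The powers of s and the exponents in 1/s add. `C` is the ratio of normalizing constants; only
its independence of `s` matters, since normalization removes it. -/
lemma invGammaPDF_mul_marginal {α γ : ℝ} (hα : 0 < α) (hγ : 0 < γ) (n : ℕ) {Q : ℝ} (hQ : 0 ≤ Q)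
    {c : ℝ} (hc : 0 < c) :
    ∃ C : ℝ, 0 < C ∧ ∀ s, invGammaPDF α γ s *
        (c * (Real.sqrt s ^ n)⁻¹ * Real.exp (-(Q / 2 / s))) =
      C * invGammaPDF ((n : ℝ) / 2 + α) ((2 * γ + Q) / 2) s := by
  have hG := Real.Gamma_pos_of_pos hα
  have hG' := Real.Gamma_pos_of_pos (show 0 < (n : ℝ) / 2 + α by positivity)
  have hq : 0 < ((2 * γ + Q) / 2) ^ ((n : ℝ) / 2 + α) := Real.rpow_pos_of_pos (by positivity) _
  have hγα := Real.rpow_pos_of_pos hγ α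
  refine ⟨c * (γ ^ α / Real.Gamma α) *
    (((2 * γ + Q) / 2) ^ ((n : ℝ) / 2 + α) / Real.Gamma ((n : ℝ) / 2 + α))⁻¹, by positivity,
    fun s => ?_⟩
  rcases le_or_gt s 0 with hs | hs
  · simp [invGammaPDF_of_nonpos hs]
  have hsα := Real.rpow_pos_of_pos hs α
  have hsn := Real.rpow_pos_of_pos hs ((n : ℝ) / 2)
  have hexp : Real.exp (-((2 * γ + Q) / 2 / s)) =
      Real.exp (-(γ / s)) * Real.exp (-(Q / 2 / s)) := by
    rw [← Real.exp_add]
    congr 1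
    ring
  rw [invGammaPDF_eq_of_pos hs, invGammaPDF_eq_of_pos hs, sqrt_pow_eq_rpow n hs.le, hexp,
    Real.rpow_add hs]
  field_simp

/-- The factor 1/s supplies the extra power in the inverse gamma density; each flat coefficient
costs half a unit of shape. The conditions on `k` and `Q` make shape and scale positive. -/
lemma jeffreys_mul_marginal {n k : ℕ} (hkn : k < n) {Q : ℝ} (hQ : 0 < Q) {c : ℝ} (hc : 0 < c) :
    ∃ C : ℝ, 0 < C ∧ ∀ s, 0 < s → 1 / s *
        (c * (Real.sqrt s ^ k * (Real.sqrt s ^ n)⁻¹) * Real.exp (-(Q / 2 / s))) =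
      C * invGammaPDF (((n : ℝ) - k) / 2) (Q / 2) s := by
  have hα : 0 < ((n : ℝ) - k) / 2 := by
    have : (k : ℝ) < n := by exact_mod_cast hkn
    linarith
  have hG := Real.Gamma_pos_of_pos hα
  have hq : 0 < (Q / 2) ^ (((n : ℝ) - k) / 2) := Real.rpow_pos_of_pos (by positivity) _
  refine ⟨c * ((Q / 2) ^ (((n : ℝ) - k) / 2) / Real.Gamma (((n : ℝ) - k) / 2))⁻¹, by positivity,
    fun s hs => ?_⟩
  have hsk := Real.rpow_pos_of_pos hs ((k : ℝ) / 2)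
  have hsn := Real.rpow_pos_of_pos hs ((n : ℝ) / 2)
  rw [invGammaPDF_eq_of_pos hs, sqrt_pow_eq_rpow n hs.le, sqrt_pow_eq_rpow k hs.le, sub_div,
    Real.rpow_sub hs]
  rw [sub_div] at hG hq
  field_simp

end InverseGamma


/-! ### Joint measurability in data and parameters. -/

section Measurability

variable {α ι κ : Type*} [MeasurableSpace α] [Fintype κ]

lemma measurable_mulE {F : α → Matrix ι κ ℝ} (hF : ∀ i j, Measurable fun a => F a i j)
    {β : α → EuclideanSpace ℝ κ} (hβ : Measurable β) : Measurable fun a => mulE (F a) (β a) := by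
  have h : Measurable fun a => F a *ᵥ (β a).ofLp := by
    refine measurable_pi_iff.2 fun i => ?_
    simp only [mulVec, dotProduct]
    fun_prop
  unfold mulE
  fun_prop

variable [Fintype ι]

lemma measurable_quad (M : Matrix ι ι ℝ) : Measurable (quad M) := by
  unfold quad
  simp only [mulVec, dotProduct]
  fun_prop

lemma measurable_gaussDensity_smul [DecidableEq ι] {R : Matrix ι ι ℝ} (hR : R.PosDef)
    {m z : α → EuclideanSpace ℝ ι} {s : α → ℝ} (hm : Measurable m) (hs : Measurable s)
    (hz : Measurable z) : Measurable fun a => gaussDensity (m a) (s a • R) (z a) := by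
  have hq (a : α) : quad (s a • R)⁻¹ (z a - m a) = (s a)⁻¹ * quad R⁻¹ (z a - m a) := by
    -- The scaling formula survives at s = 0, where the real and the matrix inverse of 0 are both 0;
    -- measurability then holds without restricting `s`.
    by_cases h : s a = 0
    · simp [h, quad]
    · simp [inv_smul_matrix R hR.det_pos.ne'.isUnit h, quad, smul_mulVec, dotProduct_smul]
  have := (measurable_quad R⁻¹).comp (hz.sub hm)
  simp only [gaussDensity, hq, det_smul]
  simp only [Function.comp_def, Pi.sub_apply] at this
  fun_prop

end Measurability

/-- Since `K` has mass 1, the constant of proportionality is forced to be the normalizing constant,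
so it never has to be computed separately. -/
lemma lintegral_and_normalize_eq {Θ : Type*} [MeasurableSpace Θ] {ν K : Measure Θ}
    [IsProbabilityMeasure K] {h : Θ → ℝ≥0∞} {c : ℝ≥0∞} (hc : c ≠ 0) (hc' : c ≠ ⊤)
    (H : ν.withDensity h = c • K) :
    ∫⁻ θ, h θ ∂ν = c ∧ (∫⁻ θ, h θ ∂ν)⁻¹ • ν.withDensity h = K := by
  have h1 : ∫⁻ θ, h θ ∂ν = c := by
    rw [← setLIntegral_univ, ← withDensity_apply _ MeasurableSet.univ, H]
    simp
  exact ⟨h1, by rw [h1, H, smul_smul, ENNReal.inv_mul_cancel hc hc', one_smul]⟩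

/-! ### Posteriors under the improper priors. -/

section Jeffreys

/-- Injectivity gives the weak inequality; in case of equality the matrix would be surjective and
miss no `z`. -/
lemma card_lt_card_of_notMem_range {ι κ : Type*} [Fintype ι] [Fintype κ] {F : Matrix ι κ ℝ}
    (hF : LinearIndependent ℝ F.col) {z : EuclideanSpace ℝ ι}
    (hz : z ∉ Set.range (mulE F)) : Fintype.card κ < Fintype.card ι := by
  have hinj : Function.Injective F.mulVecLin := mulVec_injective_iff.2 hF
  have hle : Fintype.card κ ≤ Fintype.card ι := by
    simpa using LinearMap.finrank_le_finrank_of_injective hinj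
  refine lt_of_le_of_ne hle fun h => hz ?_
  have hsurj := (LinearMap.injective_iff_surjective_of_finrank_eq_finrank (f := F.mulVecLin)
    (by simpa using h)).1 hinj
  obtain ⟨v, hv⟩ := hsurj z.ofLp
  exact ⟨WithLp.toLp 2 v, congrArg (WithLp.toLp 2) hv⟩

variable {ι κ : Type*} [Fintype ι] [DecidableEq ι] [Fintype κ] [DecidableEq κ]

lemma withDensity_eq_smul_multivariateGaussian {m : EuclideanSpace ℝ κ} {S : Matrix κ κ ℝ}
    (hS : S.PosDef) {h : EuclideanSpace ℝ κ → ℝ≥0∞} {c : ℝ} (hc : 0 ≤ c)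
    (H : ∀ β, h β = ENNReal.ofReal (c * gaussDensity m S β)) :
    volume.withDensity h = ENNReal.ofReal c • multivariateGaussian m S := by
  have : h = ENNReal.ofReal c • fun β => ENNReal.ofReal (gaussDensity m S β) := by
    ext β
    rw [H, ENNReal.ofReal_mul hc, Pi.smul_apply, smul_eq_mul]
  rw [multivariateGaussian_eq_withDensity m hS, this, withDensity_smul' _ _ ENNReal.ofReal_ne_top]

/-- The marginal likelihood under the flat prior. -/
def flatMarginal (F : Matrix ι κ ℝ) (R : Matrix ι ι ℝ) (z : EuclideanSpace ℝ ι) (s : ℝ) : ℝ :=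
  gaussConst R * (gaussConst (Fᵀ * R⁻¹ * F)⁻¹)⁻¹ *
    (Real.sqrt s ^ Fintype.card κ * (Real.sqrt s ^ Fintype.card ι)⁻¹) *
    Real.exp (-(scaleII F R z / 2 / s))

variable {F : Matrix ι κ ℝ} {R : Matrix ι ι ℝ}

lemma flatMarginal_pos (hR : R.PosDef) (hF : LinearIndependent ℝ F.col)
    (z : EuclideanSpace ℝ ι) {s : ℝ} (hs : 0 < s) : 0 < flatMarginal F R z s := by
  have h1 := gaussConst_pos hR
  have h2 := gaussConst_pos (posDef_gram hR hF).inv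
  unfold flatMarginal
  positivity

lemma flat_withDensity (hR : R.PosDef) (hF : LinearIndependent ℝ F.col)
    (z : EuclideanSpace ℝ ι) {s : ℝ} (hs : 0 < s) :
    volume.withDensity (fun β => ENNReal.ofReal (gaussDensity (mulE F β) (s • R) z)) =
      ENNReal.ofReal (flatMarginal F R z s) •
        multivariateGaussian (mulE (covII F R s) (nuII F R z s)) (covII F R s) :=
  withDensity_eq_smul_multivariateGaussian (posDef_covII hR hF hs)
    (flatMarginal_pos hR hF z hs).le fun β => by
      rw [likelihood_flat hR hF z hs, flatMarginal]

lemma lintegral_flat (hR : R.PosDef) (hF : LinearIndependent ℝ F.col)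
    (z : EuclideanSpace ℝ ι) {s : ℝ} (hs : 0 < s) :
    ∫⁻ β, ENNReal.ofReal (gaussDensity (mulE F β) (s • R) z) =
      ENNReal.ofReal (flatMarginal F R z s) :=
  (lintegral_and_normalize_eq (ENNReal.ofReal_pos.2 (flatMarginal_pos hR hF z hs)).ne'
    ENNReal.ofReal_ne_top (flat_withDensity hR hF z hs)).1

/-- The posterior distribution of the coefficients under the flat prior. -/
theorem bayes_flat (hR : R.PosDef) (hF : LinearIndependent ℝ F.col)
    (z : EuclideanSpace ℝ ι) {s : ℝ} (hs : 0 < s) :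
    0 < evidence volume (fun β => gaussDensity (mulE F β) (s • R) z) ∧
    evidence volume (fun β => gaussDensity (mulE F β) (s • R) z) < ⊤ ∧
    bayes volume (fun β => gaussDensity (mulE F β) (s • R) z) =
      multivariateGaussian (mulE (covII F R s) (nuII F R z s)) (covII F R s) := by
  have hc := ENNReal.ofReal_pos.2 (flatMarginal_pos hR hF z hs)
  obtain ⟨h1, h2⟩ := lintegral_and_normalize_eq hc.ne' ENNReal.ofReal_ne_top
    (flat_withDensity hR hF z hs)
  refine ⟨?_, ?_, h2⟩
  · rwa [evidence, h1]
  · rw [evidence, h1]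
    exact ENNReal.ofReal_lt_top

instance : SFinite jeffreys := by
  unfold jeffreys
  infer_instance

lemma lintegral_jeffreys {f : ℝ → ℝ≥0∞} (hf : Measurable f) :
    ∫⁻ s, f s ∂jeffreys = ∫⁻ s in Set.Ioi 0, ENNReal.ofReal (1 / s) * f s :=
  lintegral_withDensity_mul _ (by fun_prop) hf

lemma setLIntegral_Ioi_invGammaPDF (α q : ℝ) (f : ℝ → ℝ≥0∞) :
    ∫⁻ s in Set.Ioi 0, ENNReal.ofReal (invGammaPDF α q s) * f s =
      ∫⁻ s, ENNReal.ofReal (invGammaPDF α q s) * f s := by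
  rw [← lintegral_indicator measurableSet_Ioi]
  refine lintegral_congr fun s => ?_
  by_cases hs : 0 < s
  · rw [Set.indicator_of_mem (Set.mem_Ioi.2 hs)]
  · rw [Set.indicator_of_notMem (by simpa using hs), invGammaPDF_of_nonpos (not_lt.1 hs)]
    simp

lemma lintegral_invGamma (α q : ℝ) {f : ℝ → ℝ≥0∞} (hf : Measurable f) :
    ∫⁻ s, f s ∂invGamma α q = ∫⁻ s, ENNReal.ofReal (invGammaPDF α q s) * f s :=
  lintegral_withDensity_mul _ (measurable_invGammaPDF α q).ennreal_ofReal hf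

lemma scaleII_pos (hR : R.PosDef) (hF : LinearIndependent ℝ F.col) {z : EuclideanSpace ℝ ι}
    (hz : z ∉ Set.range (mulE F)) : 0 < scaleII F R z := by
  rw [scaleII_eq_residual hR hF]
  exact quad_pos hR.inv (sub_ne_zero.2 fun h => hz ⟨_, h.symm⟩)

/-- The posterior distribution of the variance under the Jeffreys prior. -/
theorem bayes_jeffreys (hR : R.PosDef) (hF : LinearIndependent ℝ F.col)
    {z : EuclideanSpace ℝ ι} (hz : z ∉ Set.range (mulE F)) :
    0 < evidence (volume.prod jeffreys) (fun q => gaussDensity (mulE F q.1) (q.2 • R) z) ∧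
    evidence (volume.prod jeffreys) (fun q => gaussDensity (mulE F q.1) (q.2 • R) z) < ⊤ ∧
    (bayes (volume.prod jeffreys) (fun q => gaussDensity (mulE F q.1) (q.2 • R) z)).map Prod.snd =
      invGamma (((Fintype.card ι : ℝ) - Fintype.card κ) / 2) (scaleII F R z / 2) := by
  have hkn := card_lt_card_of_notMem_range hF hz
  have hQ := scaleII_pos hR hF hz
  have hα : 0 < ((Fintype.card ι : ℝ) - Fintype.card κ) / 2 := by
    have : (Fintype.card κ : ℝ) < Fintype.card ι := by exact_mod_cast hkn
    linarith
  have := isProbabilityMeasure_invGamma hα (half_pos hQ)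
  have hc : 0 < gaussConst R * (gaussConst (Fᵀ * R⁻¹ * F)⁻¹)⁻¹ :=
    mul_pos (gaussConst_pos hR) (inv_pos.2 (gaussConst_pos (posDef_gram hR hF).inv))
  obtain ⟨C, hC, hCeq⟩ := jeffreys_mul_marginal hkn hQ hc
  have hmeas : Measurable fun q : EuclideanSpace ℝ κ × ℝ =>
      ENNReal.ofReal (gaussDensity (mulE F q.1) (q.2 • R) z) :=
    (measurable_gaussDensity_smul hR (measurable_mulE (by fun_prop) measurable_fst)
      measurable_snd measurable_const).ennreal_ofReal
  have hmap : ((volume.prod jeffreys).withDensity fun q : EuclideanSpace ℝ κ × ℝ =>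
        ENNReal.ofReal (gaussDensity (mulE F q.1) (q.2 • R) z)).map Prod.snd =
      ENNReal.ofReal C •
        invGamma (((Fintype.card ι : ℝ) - Fintype.card κ) / 2) (scaleII F R z / 2) := by
    refine Measure.ext_of_lintegral _ fun f hf => ?_
    have hmf : Measurable fun q : EuclideanSpace ℝ κ × ℝ =>
        ENNReal.ofReal (gaussDensity (mulE F q.1) (q.2 • R) z) * f q.2 :=
      hmeas.mul (hf.comp measurable_snd)
    have hmeas' : Measurable fun s : ℝ => ∫⁻ β : EuclideanSpace ℝ κ,
        ENNReal.ofReal (gaussDensity (mulE F β) (s • R) z) * f s :=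
      hmf.lintegral_prod_left'
    -- By Tonelli the coefficients are integrated first, at fixed variance, and the inverse gamma
    -- side is restricted to s > 0 to match the Jeffreys prior.
    rw [lintegral_map hf measurable_snd, lintegral_withDensity_mul _ hmeas (by fun_prop),
      lintegral_prod_symm' _ hmf, lintegral_jeffreys hmeas',
      lintegral_smul_measure, lintegral_invGamma _ _ hf, ← setLIntegral_Ioi_invGammaPDF,
      smul_eq_mul, ← lintegral_const_mul' _ _ ENNReal.ofReal_ne_top]
    refine setLIntegral_congr_fun measurableSet_Ioi fun s hs => ?_
    have hs : 0 < s := hs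
    have hms : Measurable fun β : EuclideanSpace ℝ κ =>
        ENNReal.ofReal (gaussDensity (mulE F β) (s • R) z) :=
      (measurable_gaussDensity_smul hR (measurable_mulE (by fun_prop) measurable_id)
        measurable_const measurable_const).ennreal_ofReal
    have hI : ∫⁻ β : EuclideanSpace ℝ κ, ENNReal.ofReal (gaussDensity (mulE F β) (s • R) z) =
        ENNReal.ofReal (flatMarginal F R z s) := lintegral_flat hR hF z hs
    have hprod : 1 / s * flatMarginal F R z s = C * invGammaPDF
        (((Fintype.card ι : ℝ) - Fintype.card κ) / 2) (scaleII F R z / 2) s := hCeq s hs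
    rw [lintegral_mul_const _ hms, hI, ← mul_assoc, ← mul_assoc,
      ← ENNReal.ofReal_mul (one_div_pos.2 hs).le, ← ENNReal.ofReal_mul hC.le, hprod]
  have hev : evidence (volume.prod jeffreys)
      (fun q => gaussDensity (mulE F q.1) (q.2 • R) z) = ENNReal.ofReal C := by
    -- A pushforward keeps the total mass, so the evidence is the mass of the right-hand side.
    have := congrArg (fun μ => μ Set.univ) hmap
    simp only [Measure.map_apply measurable_snd MeasurableSet.univ, Set.preimage_univ,
      withDensity_apply _ MeasurableSet.univ, Measure.restrict_univ] at this
    rw [evidence, this]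
    simp
  refine ⟨hev ▸ ENNReal.ofReal_pos.2 hC, hev ▸ ENNReal.ofReal_lt_top, ?_⟩
  rw [bayes, hev, Measure.map_smul, hmap, smul_smul,
    ENNReal.inv_mul_cancel (ENNReal.ofReal_pos.2 hC).ne' ENNReal.ofReal_ne_top, one_smul]

end Jeffreys


/-! ### Conditional distributions from joint densities. -/

section Disintegration

variable {Ω 𝓨 𝓑 : Type*} [MeasurableSpace Ω] [MeasurableSpace 𝓨] [MeasurableSpace 𝓑]
  [StandardBorelSpace 𝓑] [Nonempty 𝓑] {P : Measure Ω} [IsFiniteMeasure P]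
  {Y : Ω → 𝓨} {B : Ω → 𝓑}

lemma lintegral_of_condDistrib_ae_eq (hY : Measurable Y) (hB : Measurable B)
    {κ : 𝓨 → Measure 𝓑} (hκ : condDistrib B Y P =ᵐ[P.map Y] κ)
    {f : 𝓨 × 𝓑 → ℝ≥0∞} (hf : Measurable f) :
    ∫⁻ ω, f (Y ω, B ω) ∂P = ∫⁻ y, ∫⁻ b, f (y, b) ∂κ y ∂P.map Y := by
  rw [← lintegral_map hf (hY.prodMk hB), ← compProd_map_condDistrib hB.aemeasurable,
    Measure.lintegral_compProd hf]
  refine lintegral_congr_ae ?_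
  filter_upwards [hκ] with y hy
  rw [hy]

/-- If `(Y, B)` has a density with respect to a product measure, the conditional distribution of
`B` given `Y` is obtained by normalizing this density. -/
lemma condDistrib_ae_eq_normalize (hY : Measurable Y) (hB : Measurable B) {μ : Measure 𝓨}
    {ν : Measure 𝓑} [SFinite μ] [SFinite ν] {h : 𝓨 × 𝓑 → ℝ≥0∞} (hh : Measurable h)
    (hjoint : P.map (fun ω => (Y ω, B ω)) = (μ.prod ν).withDensity h) :
    ∀ᵐ y ∂P.map Y, ∫⁻ b, h (y, b) ∂ν ≠ 0 ∧
      condDistrib B Y P y = (∫⁻ b, h (y, b) ∂ν)⁻¹ • ν.withDensity fun b => h (y, b) := by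
  set I : 𝓨 → ℝ≥0∞ := fun y => ∫⁻ b, h (y, b) ∂ν with hI
  have hIm : Measurable I := hh.lintegral_prod_right'
  have hmap : P.map Y = μ.withDensity I := by
    refine Measure.ext_of_lintegral _ fun f hf => ?_
    have h1 : ∫⁻ y, f y ∂P.map Y = ∫⁻ q, f q.1 ∂P.map (fun ω => (Y ω, B ω)) := by
      rw [lintegral_map hf hY, lintegral_map (by fun_prop) (hY.prodMk hB)]
    rw [h1, hjoint, lintegral_withDensity_mul _ hh (by fun_prop), lintegral_prod _ (by fun_prop),
      lintegral_withDensity_mul _ hIm hf]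
    refine lintegral_congr fun y => ?_
    exact lintegral_mul_const (f := fun b => h (y, b)) (f y) (by fun_prop)
  have hfin : ∀ᵐ y ∂μ, I y < ⊤ := by
    refine ae_lt_top hIm ?_
    -- The marginal density `I` integrates to the finite mass of the law of `Y`, hence is finite
    -- almost everywhere.
    rw [← setLIntegral_univ, ← withDensity_apply _ MeasurableSet.univ, ← hmap]
    exact measure_ne_top _ _
  have hne : ∀ᵐ y ∂P.map Y, I y ≠ 0 := by
    rw [hmap, ae_withDensity_iff hIm]
    exact Filter.Eventually.of_forall fun y hy => hy
  have hkm : Measurable (Function.uncurry fun y b => (I y)⁻¹ * h (y, b)) := by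
    unfold Function.uncurry
    fun_prop
  set κ : Kernel 𝓨 𝓑 := (Kernel.const 𝓨 ν).withDensity fun y b => (I y)⁻¹ * h (y, b) with hκ
  have hκy (y : 𝓨) : κ y = ν.withDensity fun b => (I y)⁻¹ * h (y, b) := by
    rw [hκ, Kernel.withDensity_apply _ hkm, Kernel.const_apply]
  have : IsFiniteKernel κ := by
    refine ⟨1, ENNReal.one_lt_top, fun y => ?_⟩
    rw [hκy, withDensity_apply _ MeasurableSet.univ, Measure.restrict_univ,
      lintegral_const_mul _ (by fun_prop)]
    -- The bound also covers I y = 0 and I y = ⊤, where the product of the inverse with `I y` is 0.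
    exact ENNReal.inv_mul_le_one _
  have hcond : condDistrib B Y P =ᵐ[P.map Y] κ := by
    refine condDistrib_ae_eq_of_measure_eq_compProd Y hB.aemeasurable ?_
    refine Measure.ext_of_lintegral _ fun f hf => ?_
    rw [hjoint, lintegral_withDensity_mul _ hh hf, lintegral_prod _ (by fun_prop),
      Measure.lintegral_compProd hf, hmap,
      lintegral_withDensity_mul _ hIm hf.lintegral_kernel_prod_right']
    refine lintegral_congr_ae ?_
    filter_upwards [hfin] with y hy
    rw [hκy, lintegral_withDensity_mul _ (by fun_prop) (by fun_prop)]
    -- Where the marginal density vanishes, so does `h (y, ·)` almost everywhere, and both sides are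
    -- 0.
    by_cases h0 : I y = 0
    · rw [h0, zero_mul]
      have := (lintegral_eq_zero_iff (by fun_prop)).1 h0
      rw [lintegral_eq_zero_iff (by fun_prop)]
      filter_upwards [this] with b hb
      simp_all
    · rw [← lintegral_const_mul' _ _ hy.ne]
      refine lintegral_congr fun b => ?_
      rw [← mul_assoc, ← mul_assoc, ENNReal.mul_inv_cancel h0 hy.ne, one_mul]
  filter_upwards [hcond, hne] with y hy hy0
  refine ⟨hy0, ?_⟩
  rw [hy, hκy]
  exact withDensity_smul _ (by fun_prop)

/-- Conditioning on `Y` is the same as conditioning on an injective measurable image of `Y`. -/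
lemma condDistrib_comp_leftInverse {𝓩 : Type*} [MeasurableSpace 𝓩] (hY : Measurable Y)
    (hB : Measurable B) {e : 𝓨 → 𝓩} {g : 𝓩 → 𝓨} (he : Measurable e) (hg : Measurable g)
    (hge : ∀ y, g (e y) = y) :
    ∀ᵐ y ∂P.map Y, condDistrib B Y P y = condDistrib B (fun ω => e (Y ω)) P (e y) := by
  have : condDistrib B Y P =ᵐ[P.map Y] (condDistrib B (fun ω => e (Y ω)) P).comap e he := by
    refine condDistrib_ae_eq_of_measure_eq_compProd Y hB.aemeasurable ?_
    refine Measure.ext_of_lintegral _ fun f hf => ?_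
    have h1 := lintegral_of_condDistrib_ae_eq (P := P) (he.comp hY) hB (Filter.EventuallyEq.refl _ _)
      (f := fun q => f (g q.1, q.2)) (by fun_prop)
    simp only [Function.comp_apply, hge] at h1
    have hm : Measurable fun z => ∫⁻ b, f (g z, b) ∂condDistrib B (fun ω => e (Y ω)) P z :=
      Measurable.lintegral_kernel_prod_right' (f := fun q : 𝓩 × 𝓑 => f (g q.1, q.2)) (by fun_prop)
    rw [lintegral_map hf (hY.prodMk hB), h1, Measure.lintegral_compProd hf,
      lintegral_map hf.lintegral_kernel_prod_right' hY]
    erw [lintegral_map hm (he.comp hY)]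
    simp only [Function.comp_apply, hge, Kernel.comap_apply]
  filter_upwards [this] with y hy
  rw [hy, Kernel.comap_apply]

end Disintegration

/-! ### Conditional distributions under the conjugate prior, with a random design. -/

section Conjugate

variable {Ω 𝓧 ι κ : Type*} [MeasurableSpace Ω] [MeasurableSpace 𝓧]
  [Fintype ι] [DecidableEq ι] [Fintype κ] [DecidableEq κ]
  {P : Measure Ω} [IsProbabilityMeasure P]
  {X : Ω → 𝓧} {S : Ω → ℝ} {B : Ω → EuclideanSpace ℝ κ} {Z : Ω → EuclideanSpace ℝ ι}
  {F : 𝓧 → Matrix ι κ ℝ} {R : Matrix ι ι ℝ} {V : Matrix κ κ ℝ} {b : EuclideanSpace ℝ κ} {α γ : ℝ}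

/-- The joint density of the observations `z`, the variance `s` and the coefficients `β`, given
the design matrix. -/
def conjugateDensity (F : Matrix ι κ ℝ) (R : Matrix ι ι ℝ) (V : Matrix κ κ ℝ)
    (b : EuclideanSpace ℝ κ) (α γ : ℝ) (z : EuclideanSpace ℝ ι) (s : ℝ)
    (β : EuclideanSpace ℝ κ) : ℝ≥0∞ :=
  ENNReal.ofReal (invGammaPDF α γ s) * (ENNReal.ofReal (gaussDensity b (s • V) β) *
    ENNReal.ofReal (gaussDensity (mulE F β) (s • R) z))

lemma measurable_conjugateDensity {𝓐 : Type*} [MeasurableSpace 𝓐] (hR : R.PosDef) (hV : V.PosDef)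
    {F : 𝓐 → Matrix ι κ ℝ} (hF : ∀ i j, Measurable fun x => F x i j) (b : EuclideanSpace ℝ κ)
    (α γ : ℝ) {z : 𝓐 → EuclideanSpace ℝ ι} {s : 𝓐 → ℝ} {β : 𝓐 → EuclideanSpace ℝ κ}
    (hz : Measurable z) (hs : Measurable s) (hβ : Measurable β) :
    Measurable fun a => conjugateDensity (F a) R V b α γ (z a) (s a) (β a) := by
  have h1 := measurable_gaussDensity_smul hR (measurable_mulE hF hβ) hs hz
  have h2 := measurable_gaussDensity_smul hV (measurable_const (a := b)) hs hβ
  have h3 := (measurable_invGammaPDF α γ).comp hs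
  exact h3.ennreal_ofReal.mul (h2.ennreal_ofReal.mul h1.ennreal_ofReal)

/-- The factor of the joint density that does not depend on the coefficients, in the informative
case. -/
def priorMarginal (F : Matrix ι κ ℝ) (R : Matrix ι ι ℝ) (V : Matrix κ κ ℝ)
    (b : EuclideanSpace ℝ κ) (z : EuclideanSpace ℝ ι) (s : ℝ) : ℝ :=
  gaussConst R * gaussConst V * (gaussConst (Fᵀ * R⁻¹ * F + V⁻¹)⁻¹)⁻¹ *
    (Real.sqrt s ^ Fintype.card ι)⁻¹ *
    Real.exp (-(ridgeScale F R V⁻¹ b z (ridge F R V⁻¹ b z) / 2 / s))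

lemma priorMarginal_pos {F : Matrix ι κ ℝ} (hR : R.PosDef) (hV : V.PosDef)
    (b : EuclideanSpace ℝ κ) (z : EuclideanSpace ℝ ι) {s : ℝ} (hs : 0 < s) :
    0 < priorMarginal F R V b z s := by
  have h1 := gaussConst_pos hR
  have h2 := gaussConst_pos hV
  have h3 := gaussConst_pos (posDef_gram_add (F := F) hR hV).inv
  unfold priorMarginal
  positivity

lemma withDensity_conjugateDensity {F : Matrix ι κ ℝ} (hR : R.PosDef) (hV : V.PosDef)
    (b : EuclideanSpace ℝ κ) (hα : 0 < α) (hγ : 0 < γ) (z : EuclideanSpace ℝ ι) {s : ℝ}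
    (hs : 0 < s) :
    volume.withDensity (conjugateDensity F R V b α γ z s) =
      ENNReal.ofReal (invGammaPDF α γ s * priorMarginal F R V b z s) •
        multivariateGaussian (mulE (covI F R V s) (nuI F R V b z s)) (covI F R V s) := by
  have h0 := invGammaPDF_nonneg hα hγ s
  refine withDensity_eq_smul_multivariateGaussian (posDef_covI hR hV hs)
    (mul_nonneg h0 (priorMarginal_pos hR hV b z hs).le) fun β => ?_
  rw [conjugateDensity, ← ENNReal.ofReal_mul (gaussDensity_nonneg _ _ _),
    likelihood_mul_prior hR hV b z hs, ← ENNReal.ofReal_mul h0, priorMarginal, ← mul_assoc]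

lemma lintegral_conjugateDensity {F : Matrix ι κ ℝ} (hR : R.PosDef) (hV : V.PosDef)
    (b : EuclideanSpace ℝ κ) (hα : 0 < α) (hγ : 0 < γ) (z : EuclideanSpace ℝ ι) (s : ℝ) :
    ∫⁻ β, conjugateDensity F R V b α γ z s β =
      ENNReal.ofReal (invGammaPDF α γ s * priorMarginal F R V b z s) := by
  rcases le_or_gt s 0 with hs | hs
  · simp [conjugateDensity, invGammaPDF_of_nonpos hs]
  · rw [← setLIntegral_univ, ← withDensity_apply _ MeasurableSet.univ,
      withDensity_conjugateDensity hR hV b hα hγ z hs]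
    simp

lemma ae_invGamma_pos (α q : ℝ) : ∀ᵐ s ∂invGamma α q, 0 < s := by
  rw [invGamma, ae_withDensity_iff (measurable_invGammaPDF α q).ennreal_ofReal]
  refine Filter.Eventually.of_forall fun s h => ?_
  by_contra hs
  exact h (by rw [invGammaPDF_of_nonpos (not_lt.1 hs), ENNReal.ofReal_zero])

lemma ae_pos_of_condDistrib_eq_invGamma {P : Measure Ω} [IsFiniteMeasure P] {X : Ω → 𝓧}
    (hS : Measurable S) (hSlaw : condDistrib S X P =ᵐ[P.map X] fun _ => invGamma α γ) :
    ∀ᵐ y ∂P.map (fun ω => (X ω, S ω)), 0 < y.2 := by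
  rw [← compProd_map_condDistrib hS.aemeasurable,
    Measure.ae_compProd_iff (measurableSet_lt measurable_const measurable_snd)]
  filter_upwards [hSlaw] with x hx
  rw [hx]
  exact ae_invGamma_pos α γ

/-- The chain rule: the law of `X`, the inverse gamma kernel, the Gaussian kernel and the likelihood
are composed, and Tonelli reorders the integrals so that β is innermost and can be integrated out,
followed by s. No density of `X` is needed. The likelihood enters as an integral identity, the form
in which the model delivers it. -/
lemma lintegral_conjugate_joint (hX : Measurable X) (hS : Measurable S) (hB : Measurable B)
    (hF : ∀ i j, Measurable fun x => F x i j) (hR : R.PosDef) (hV : V.PosDef)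
    (hSlaw : condDistrib S X P =ᵐ[P.map X] fun _ => invGamma α γ)
    (hBlaw : condDistrib B (fun ω => (X ω, S ω)) P =ᵐ[P.map fun ω => (X ω, S ω)]
      fun y => multivariateGaussian b (y.2 • V))
    (hZlaw : ∀ f : 𝓧 × ℝ × EuclideanSpace ℝ κ × EuclideanSpace ℝ ι → ℝ≥0∞, Measurable f →
      ∫⁻ ω, f (X ω, S ω, B ω, Z ω) ∂P = ∫⁻ ω, (∫⁻ z,
        ENNReal.ofReal (gaussDensity (mulE (F (X ω)) (B ω)) (S ω • R) z) *
          f (X ω, S ω, B ω, z)) ∂P)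
    {f : 𝓧 × ℝ × EuclideanSpace ℝ κ × EuclideanSpace ℝ ι → ℝ≥0∞} (hf : Measurable f) :
    ∫⁻ ω, f (X ω, S ω, B ω, Z ω) ∂P =
      ∫⁻ x, (∫⁻ z, ∫⁻ s, ∫⁻ β, conjugateDensity (F x) R V b α γ z s β * f (x, s, β, z))
        ∂P.map X := by
  have hXS : Measurable fun ω => (X ω, S ω) := hX.prodMk hS
  have hpos := ae_pos_of_condDistrib_eq_invGamma hS hSlaw
  have hB' : condDistrib B (fun ω => (X ω, S ω)) P =ᵐ[P.map fun ω => (X ω, S ω)]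
      fun y => volume.withDensity fun β => ENNReal.ofReal (gaussDensity b (y.2 • V) β) := by
    filter_upwards [hBlaw, hpos] with y hy hy0
    rw [hy, multivariateGaussian_eq_withDensity _ (hV.smul hy0)]
  have hgd1 : Measurable fun q : 𝓧 × ℝ × EuclideanSpace ℝ κ × EuclideanSpace ℝ ι =>
      ENNReal.ofReal (gaussDensity (mulE (F q.1) q.2.2.1) (q.2.1 • R) q.2.2.2) :=
    (measurable_gaussDensity_smul hR (measurable_mulE (fun i j => (hF i j).comp measurable_fst)
      (by fun_prop)) (by fun_prop) (by fun_prop)).ennreal_ofReal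
  have hgd2 : Measurable fun q : ℝ × EuclideanSpace ℝ κ =>
      ENNReal.ofReal (gaussDensity b (q.1 • V) q.2) :=
    (measurable_gaussDensity_smul hV measurable_const (by fun_prop) (by fun_prop)).ennreal_ofReal
  have hgd2' (s : ℝ) : Measurable fun β => ENNReal.ofReal (gaussDensity b (s • V) β) :=
    (measurable_gaussDensity_smul hV measurable_const measurable_const measurable_id).ennreal_ofReal
  have hgf := hgd1.fun_mul hf
  have hG : Measurable fun q : (𝓧 × ℝ) × EuclideanSpace ℝ κ => ∫⁻ z,
      ENNReal.ofReal (gaussDensity (mulE (F q.1.1) q.2) (q.1.2 • R) z) *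
        f (q.1.1, q.1.2, q.2, z) :=
    Measurable.lintegral_prod_right'
      (f := fun q : ((𝓧 × ℝ) × EuclideanSpace ℝ κ) × EuclideanSpace ℝ ι =>
        ENNReal.ofReal (gaussDensity (mulE (F q.1.1.1) q.1.2) (q.1.1.2 • R) q.2) *
          f (q.1.1.1, q.1.1.2, q.1.2, q.2))
      (hgf.comp (f := fun q : ((𝓧 × ℝ) × EuclideanSpace ℝ κ) × EuclideanSpace ℝ ι =>
        (q.1.1.1, q.1.1.2, q.1.2, q.2)) (by fun_prop))
  have hK : Measurable fun q : 𝓧 × ℝ => ∫⁻ β, ENNReal.ofReal (gaussDensity b (q.2 • V) β) *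
      ∫⁻ z, ENNReal.ofReal (gaussDensity (mulE (F q.1) β) (q.2 • R) z) *
        f (q.1, q.2, β, z) :=
    Measurable.lintegral_prod_right' (f := fun q : (𝓧 × ℝ) × EuclideanSpace ℝ κ =>
      ENNReal.ofReal (gaussDensity b (q.1.2 • V) q.2) *
        ∫⁻ z, ENNReal.ofReal (gaussDensity (mulE (F q.1.1) q.2) (q.1.2 • R) z) *
          f (q.1.1, q.1.2, q.2, z))
      ((hgd2.comp (f := fun q : (𝓧 × ℝ) × EuclideanSpace ℝ κ => (q.1.2, q.2))
        (by fun_prop)).mul hG)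
  have hH : Measurable fun q : 𝓧 × ℝ × EuclideanSpace ℝ κ × EuclideanSpace ℝ ι =>
      conjugateDensity (F q.1) R V b α γ q.2.2.2 q.2.1 q.2.2.1 * f q :=
    (measurable_conjugateDensity hR hV (fun i j => (hF i j).comp measurable_fst) b α γ
      (by fun_prop) (by fun_prop) (by fun_prop)).mul hf
  calc ∫⁻ ω, f (X ω, S ω, B ω, Z ω) ∂P
      = ∫⁻ ω, (∫⁻ z, ENNReal.ofReal (gaussDensity (mulE (F (X ω)) (B ω)) (S ω • R) z) *
          f (X ω, S ω, B ω, z)) ∂P := hZlaw f hf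
    _ = ∫⁻ y, (∫⁻ β, ENNReal.ofReal (gaussDensity b (y.2 • V) β) *
          ∫⁻ z, ENNReal.ofReal (gaussDensity (mulE (F y.1) β) (y.2 • R) z) *
            f (y.1, y.2, β, z)) ∂P.map (fun ω => (X ω, S ω)) := by
        rw [lintegral_of_condDistrib_ae_eq hXS hB hB' hG]
        refine lintegral_congr fun y => ?_
        exact lintegral_withDensity_mul _ (hgd2' y.2) (hG.comp (measurable_prodMk_left (x := y)))
    _ = ∫⁻ x, (∫⁻ s, ENNReal.ofReal (invGammaPDF α γ s) *
          ∫⁻ β, ENNReal.ofReal (gaussDensity b (s • V) β) *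
          ∫⁻ z, ENNReal.ofReal (gaussDensity (mulE (F x) β) (s • R) z) *
            f (x, s, β, z)) ∂P.map X := by
        rw [lintegral_map hK hXS, lintegral_of_condDistrib_ae_eq hX hS hSlaw hK]
        refine lintegral_congr fun x => ?_
        exact lintegral_invGamma _ _ (hK.comp (measurable_prodMk_left (x := x)))
    _ = ∫⁻ x, (∫⁻ s, ∫⁻ β, ∫⁻ z, conjugateDensity (F x) R V b α γ z s β * f (x, s, β, z))
          ∂P.map X := by
        refine lintegral_congr fun x => lintegral_congr fun s => ?_
        rw [← lintegral_const_mul' _ _ ENNReal.ofReal_ne_top]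
        refine lintegral_congr fun β => ?_
        rw [← lintegral_const_mul' _ _ ENNReal.ofReal_ne_top,
          ← lintegral_const_mul' _ _ ENNReal.ofReal_ne_top]
        refine lintegral_congr fun z => ?_
        simp only [conjugateDensity, mul_assoc]
    _ = _ := by
        refine lintegral_congr fun x => ?_
        have hm1 : Measurable fun q : ℝ × EuclideanSpace ℝ ι =>
            ∫⁻ β, conjugateDensity (F x) R V b α γ q.2 q.1 β * f (x, q.1, β, q.2) :=
          Measurable.lintegral_prod_right'
            (f := fun q : (ℝ × EuclideanSpace ℝ ι) × EuclideanSpace ℝ κ =>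
              conjugateDensity (F x) R V b α γ q.1.2 q.1.1 q.2 * f (x, q.1.1, q.2, q.1.2))
            (hH.comp (f := fun q : (ℝ × EuclideanSpace ℝ ι) × EuclideanSpace ℝ κ =>
              (x, q.1.1, q.2, q.1.2)) (by fun_prop))
        refine Eq.trans ?_ (lintegral_lintegral_swap (f := fun s z => ∫⁻ β,
          conjugateDensity (F x) R V b α γ z s β * f (x, s, β, z)) hm1.aemeasurable)
        refine lintegral_congr fun s => ?_
        exact lintegral_lintegral_swap (hH.comp (f := fun q : EuclideanSpace ℝ κ ×
          EuclideanSpace ℝ ι => (x, s, q.1, q.2)) (by fun_prop)).aemeasurable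

/-- Conjugacy: the conditional distribution of the coefficients. -/
theorem condDistrib_coeff_ae_eq (hX : Measurable X) (hS : Measurable S) (hB : Measurable B)
    (hZ : Measurable Z)
    (hF : ∀ i j, Measurable fun x => F x i j) (hR : R.PosDef) (hV : V.PosDef)
    (hα : 0 < α) (hγ : 0 < γ)
    (hjoint : ∀ f : 𝓧 × ℝ × EuclideanSpace ℝ κ × EuclideanSpace ℝ ι → ℝ≥0∞, Measurable f →
      ∫⁻ ω, f (X ω, S ω, B ω, Z ω) ∂P = ∫⁻ x, (∫⁻ z, ∫⁻ s, ∫⁻ β,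
        conjugateDensity (F x) R V b α γ z s β * f (x, s, β, z)) ∂P.map X) :
    ∀ᵐ y ∂P.map (fun ω => (X ω, Z ω, S ω)),
      condDistrib B (fun ω => (X ω, Z ω, S ω)) P y =
        multivariateGaussian (mulE (covI (F y.1) R V y.2.2) (nuI (F y.1) R V b y.2.1 y.2.2))
          (covI (F y.1) R V y.2.2) := by
  have hh : Measurable fun q : (𝓧 × EuclideanSpace ℝ ι × ℝ) × EuclideanSpace ℝ κ =>
      conjugateDensity (F q.1.1) R V b α γ q.1.2.1 q.1.2.2 q.2 :=
    measurable_conjugateDensity hR hV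
      (fun i j => (hF i j).comp (measurable_fst.comp measurable_fst)) b α γ
      (by fun_prop) (by fun_prop) (by fun_prop)
  have hY : Measurable fun ω => (X ω, Z ω, S ω) := hX.prodMk (hZ.prodMk hS)
  have hlaw : P.map (fun ω => ((X ω, Z ω, S ω), B ω)) =
      (((P.map X).prod (volume.prod volume)).prod volume).withDensity
        fun q : (𝓧 × EuclideanSpace ℝ ι × ℝ) × EuclideanSpace ℝ κ =>
          conjugateDensity (F q.1.1) R V b α γ q.1.2.1 q.1.2.2 q.2 := by
    refine Measure.ext_of_lintegral _ fun f hf => ?_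
    have hhf := hh.fun_mul hf
    rw [lintegral_map hf (hY.prodMk hB), lintegral_withDensity_mul _ hh hf,
      hjoint (fun q => f ((q.1, q.2.2.2, q.2.1), q.2.2.1)) (by fun_prop),
      lintegral_prod _ hhf.aemeasurable, lintegral_prod _ hhf.lintegral_prod_right'.aemeasurable]
    refine lintegral_congr fun x => ?_
    have hm : Measurable fun p : EuclideanSpace ℝ ι × ℝ => ∫⁻ β,
        conjugateDensity (F x) R V b α γ p.1 p.2 β * f ((x, p), β) :=
      hhf.lintegral_prod_right'.comp measurable_prodMk_left
    exact (lintegral_prod _ hm.aemeasurable).symm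
  filter_upwards [condDistrib_ae_eq_normalize hY hB hh hlaw] with y ⟨hy0, hy⟩
  -- The joint density vanishes for nonpositive variance, whereas its integral is almost surely
  -- nonzero.
  have hs : 0 < y.2.2 := by
    by_contra hs
    exact hy0 (by simp [conjugateDensity, invGammaPDF_of_nonpos (not_lt.1 hs)])
  have hd := withDensity_conjugateDensity (F := F y.1) hR hV b hα hγ y.2.1 hs
  rw [hy]
  refine (lintegral_and_normalize_eq ?_ ENNReal.ofReal_ne_top hd).2
  rwa [lintegral_conjugateDensity hR hV b hα hγ] at hy0

lemma ridgeScale_nonneg {F : Matrix ι κ ℝ} (hR : R.PosDef) (hV : V.PosDef)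
    (b : EuclideanSpace ℝ κ) (z : EuclideanSpace ℝ ι) (m : EuclideanSpace ℝ κ) :
    0 ≤ ridgeScale F R V⁻¹ b z m :=
  add_nonneg (quad_nonneg hR.inv.posSemidef _) (quad_nonneg hV.inv.posSemidef _)

/-- Conjugacy: the conditional distribution of the variance. -/
theorem condDistrib_variance_ae_eq (hX : Measurable X) (hS : Measurable S) (hZ : Measurable Z)
    (hF : ∀ i j, Measurable fun x => F x i j) (hR : R.PosDef) (hV : V.PosDef)
    (hα : 0 < α) (hγ : 0 < γ)
    (hjoint : ∀ f : 𝓧 × ℝ × EuclideanSpace ℝ κ × EuclideanSpace ℝ ι → ℝ≥0∞, Measurable f →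
      ∫⁻ ω, f (X ω, S ω, B ω, Z ω) ∂P = ∫⁻ x, (∫⁻ z, ∫⁻ s, ∫⁻ β,
        conjugateDensity (F x) R V b α γ z s β * f (x, s, β, z)) ∂P.map X) :
    ∀ᵐ y ∂P.map (fun ω => (X ω, Z ω)), LinearIndependent ℝ (F y.1).col →
      condDistrib S (fun ω => (X ω, Z ω)) P y =
        invGamma ((Fintype.card ι : ℝ) / 2 + α) (scaleI (F y.1) R V b γ y.2 / 2) := by
  have hh : Measurable fun q : ((𝓧 × EuclideanSpace ℝ ι) × ℝ) × EuclideanSpace ℝ κ =>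
      conjugateDensity (F q.1.1.1) R V b α γ q.1.1.2 q.1.2 q.2 :=
    measurable_conjugateDensity hR hV
      (fun i j => (hF i j).comp (measurable_fst.comp (measurable_fst.comp measurable_fst))) b α γ
      (by fun_prop) (by fun_prop) (by fun_prop)
  have hh' : Measurable fun q : (𝓧 × EuclideanSpace ℝ ι) × ℝ =>
      ∫⁻ β, conjugateDensity (F q.1.1) R V b α γ q.1.2 q.2 β := hh.lintegral_prod_right'
  have hY : Measurable fun ω => (X ω, Z ω) := hX.prodMk hZ
  have hlaw : P.map (fun ω => ((X ω, Z ω), S ω)) =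
      (((P.map X).prod volume).prod volume).withDensity
        fun q : (𝓧 × EuclideanSpace ℝ ι) × ℝ =>
          ∫⁻ β, conjugateDensity (F q.1.1) R V b α γ q.1.2 q.2 β := by
    refine Measure.ext_of_lintegral _ fun f hf => ?_
    have hhf := hh'.fun_mul hf
    rw [lintegral_map hf (hY.prodMk hS), lintegral_withDensity_mul _ hh' hf,
      hjoint (fun q => f ((q.1, q.2.2.2), q.2.1)) (by fun_prop),
      lintegral_prod _ hhf.aemeasurable, lintegral_prod _ hhf.lintegral_prod_right'.aemeasurable]
    refine lintegral_congr fun x => lintegral_congr fun z => lintegral_congr fun s => ?_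
    exact lintegral_mul_const (f := fun β => conjugateDensity (F x) R V b α γ z s β)
      (f ((x, z), s)) (hh.comp (measurable_prodMk_left (x := ((x, z), s))))
  filter_upwards [condDistrib_ae_eq_normalize hY hS hh' hlaw] with y hy' hli
  have hy := hy'.2
  have hQ := ridgeScale_nonneg (F := F y.1) hR hV b y.2 (ridge (F y.1) R V⁻¹ b y.2)
  have hc : 0 < gaussConst R * gaussConst V * (gaussConst ((F y.1)ᵀ * R⁻¹ * F y.1 + V⁻¹)⁻¹)⁻¹ :=
    mul_pos (mul_pos (gaussConst_pos hR) (gaussConst_pos hV))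
      (inv_pos.2 (gaussConst_pos (posDef_gram_add hR hV).inv))
  obtain ⟨C, hC, hCeq⟩ := invGammaPDF_mul_marginal hα hγ (Fintype.card ι) hQ hc
  -- Linear independence enters through the form of Q alone, which involves the inverse of the Gram
  -- matrix.
  rw [two_mul_add_ridgeScale hR hV hli] at hCeq
  have := isProbabilityMeasure_invGamma (α := (Fintype.card ι : ℝ) / 2 + α)
    (q := scaleI (F y.1) R V b γ y.2 / 2) (by positivity)
    (by rw [← two_mul_add_ridgeScale hR hV hli]; positivity)
  rw [hy]
  refine (lintegral_and_normalize_eq (ENNReal.ofReal_pos.2 hC).ne' ENNReal.ofReal_ne_top ?_).2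
  rw [invGamma, ← withDensity_smul' _ _ ENNReal.ofReal_ne_top]
  congr 1
  ext s
  rw [lintegral_conjugateDensity hR hV b hα hγ, Pi.smul_apply, smul_eq_mul,
    ← ENNReal.ofReal_mul hC.le, ← hCeq, priorMarginal]

end Conjugate


/-! ### The likelihood of the two-level model. -/

section CoKrigingModel

variable {d p₁ p₂ n₁ n₂ : ℕ} {D : Set (EuclideanSpace ℝ (Fin d))}
  {f₁ : D → Fin p₁ → ℝ} {f₂ : D → Fin p₂ → ℝ} {r₁ r₂ : EuclideanSpace ℝ (Fin d) → ℝ}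
  {x₁ : Fin n₁ → D} {x₂ : Fin n₂ → D} {e : Fin n₂ → Fin n₁}

/-- The part `ρ z₁(D₂)` of the second level that comes from the first one. -/
def carry {p : ℕ} (e : Fin n₂ → Fin n₁) (u : EuclideanSpace ℝ (Fin n₁))
    (l : EuclideanSpace ℝ (Unit ⊕ Fin p)) : EuclideanSpace ℝ (Fin n₂) :=
  WithLp.toLp 2 fun i => rho l * u (e i)

lemma measurable_carry {p : ℕ} (e : Fin n₂ → Fin n₁) :
    Measurable fun q : EuclideanSpace ℝ (Fin n₁) × EuclideanSpace ℝ (Unit ⊕ Fin p) =>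
      carry e q.1 q.2 := by
  unfold carry rho
  fun_prop

lemma measurable_design₂ (f₂ : D → Fin p₂ → ℝ) (x₂ : Fin n₂ → D) (e : Fin n₂ → Fin n₁)
    (i : Fin n₂) (j : Unit ⊕ Fin p₂) : Measurable fun u => design₂ f₂ x₂ e u i j := by
  cases j with
  | inl j =>
    simp only [design₂, of_apply, Sum.elim_inl]
    fun_prop
  | inr j =>
    simp only [design₂, of_apply, Sum.elim_inr]
    fun_prop

lemma mulE_design₂ (f₂ : D → Fin p₂ → ℝ) (x₂ : Fin n₂ → D) (e : Fin n₂ → Fin n₁)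
    (u : EuclideanSpace ℝ (Fin n₁)) (l : EuclideanSpace ℝ (Unit ⊕ Fin p₂)) :
    mulE (design₂ f₂ x₂ e u) l = carry e u l + mulE (design f₂ x₂) (beta₂ l) := by
  ext i
  simp [mulE, design₂, carry, design, beta₂, rho, mulVec, dotProduct, mul_comm]

lemma gaussDensity_add_left {ι : Type*} [Fintype ι] [DecidableEq ι] (a m z : EuclideanSpace ℝ ι)
    (S : Matrix ι ι ℝ) : gaussDensity (a + m) S (a + z) = gaussDensity m S z := by
  rw [gaussDensity, gaussDensity, add_sub_add_left_eq_sub]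

lemma lintegral_gaussDensity {ι : Type*} [Fintype ι] [DecidableEq ι] (m : EuclideanSpace ℝ ι)
    {S : Matrix ι ι ℝ} (hS : S.PosDef) : ∫⁻ z, ENNReal.ofReal (gaussDensity m S z) = 1 := by
  rw [← setLIntegral_univ, ← withDensity_apply _ MeasurableSet.univ,
    ← multivariateGaussian_eq_withDensity m hS, measure_univ]

lemma lintegral_multivariateGaussian_smul {ι : Type*} [Fintype ι] [DecidableEq ι]
    (m : EuclideanSpace ℝ ι) {R : Matrix ι ι ℝ} (hR : R.PosDef) {s : ℝ} (hs : 0 < s)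
    {f : EuclideanSpace ℝ ι → ℝ≥0∞} (hf : Measurable f) :
    ∫⁻ z, f z ∂multivariateGaussian m (s • R) =
      ∫⁻ z, ENNReal.ofReal (gaussDensity m (s • R) z) * f z := by
  rw [multivariateGaussian_eq_withDensity m (hR.smul hs)]
  exact lintegral_withDensity_mul _ (measurable_gaussDensity m _).ennreal_ofReal hf

/-- For fixed `u`, translating the δ-sample by ρ u(D₂) changes the mean F₂ β₂ into the mean of the
level-two regression (`mulE_design₂`) and preserves Lebesgue measure. This yields the factorization
p(z₁) p(z₂ | z₁). -/
lemma lintegral_pairLaw (hR₁ : (corr r₁ x₁).PosDef) (hR₂ : (corr r₂ x₂).PosDef)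
    {θ : Param p₁ p₂} (hs₁ : 0 < θ.1) (hs₂ : 0 < θ.2.2.1)
    {k : EuclideanSpace ℝ (Fin n₁) × EuclideanSpace ℝ (Fin n₂) → ℝ≥0∞} (hk : Measurable k) :
    ∫⁻ q, k (q.1, carry e q.1 θ.2.2.2 + q.2) ∂pairLaw f₁ f₂ r₁ r₂ x₁ x₂ θ =
      ∫⁻ u, ENNReal.ofReal (gaussDensity (mulE (design f₁ x₁) θ.2.1) (θ.1 • corr r₁ x₁) u) *
        ∫⁻ w, ENNReal.ofReal
          (gaussDensity (mulE (design₂ f₂ x₂ e u) θ.2.2.2) (θ.2.2.1 • corr r₂ x₂) w) *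
            k (u, w) := by
  have hc : Measurable fun q : EuclideanSpace ℝ (Fin n₁) × EuclideanSpace ℝ (Fin n₂) =>
      k (q.1, carry e q.1 θ.2.2.2 + q.2) := by
    have := (measurable_carry e).comp
      (measurable_id.prodMk (measurable_const (a := θ.2.2.2)))
    simp only [Function.comp_def, id] at this
    fun_prop
  rw [pairLaw, lintegral_prod _ hc.aemeasurable,
    lintegral_multivariateGaussian_smul _ hR₁ hs₁ hc.lintegral_prod_right']
  refine lintegral_congr fun u => ?_
  congr 1
  refine (lintegral_multivariateGaussian_smul _ hR₂ hs₂
    (hc.comp (measurable_prodMk_left (x := u)))).trans ?_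
  rw [← lintegral_add_left_eq_self (fun w => ENNReal.ofReal
    (gaussDensity (mulE (design₂ f₂ x₂ e u) θ.2.2.2) (θ.2.2.1 • corr r₂ x₂) w) * k (u, w))
    (carry e u θ.2.2.2)]
  refine lintegral_congr fun v => ?_
  rw [mulE_design₂, gaussDensity_add_left]
  rfl

lemma sample_autoregressive {Ω : Type*} {Z₁ Z₂ δ : D → Ω → ℝ}
    {l : Ω → EuclideanSpace ℝ (Unit ⊕ Fin p₂)}
    (h : ∀ x ω, Z₂ x ω = rho (l ω) * Z₁ x ω + δ x ω) (he : ∀ i, x₂ i = x₁ (e i)) (ω : Ω) :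
    sample Z₂ x₂ ω = carry e (sample Z₁ x₁ ω) (l ω) + sample δ x₂ ω := by
  ext i
  simp [sample, carry, h, he]

lemma measurable_sample {Ω : Type*} [MeasurableSpace Ω] {Z : D → Ω → ℝ}
    (hZ : ∀ x, Measurable (Z x)) {n : ℕ} (x : Fin n → D) : Measurable (sample Z x) := by
  unfold sample
  fun_prop

/-- The joint density of the observations of the two levels. -/
theorem FixedModel.map_sample {Ω : Type*} [MeasurableSpace Ω] {P : Measure Ω}
    (hR₁ : (corr r₁ x₁).PosDef) (hR₂ : (corr r₂ x₂).PosDef) (he : ∀ i, x₂ i = x₁ (e i))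
    {s₁ : ℝ} {β₁ : EuclideanSpace ℝ (Fin p₁)} {s₂ : ℝ}
    {l : EuclideanSpace ℝ (Unit ⊕ Fin p₂)} (hs₁ : 0 < s₁) (hs₂ : 0 < s₂)
    {Z₁ Z₂ δ : D → Ω → ℝ} (h : FixedModel P f₁ f₂ r₁ r₂ (s₁, β₁, s₂, l) Z₁ Z₂ δ) :
    P.map (fun ω => (sample Z₁ x₁ ω, sample Z₂ x₂ ω)) =
      volume.withDensity fun y => ENNReal.ofReal
        (gaussDensity (mulE (design f₁ x₁) β₁) (s₁ • corr r₁ x₁) y.1 *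
          gaussDensity (mulE (design₂ f₂ x₂ e y.1) l) (s₂ • corr r₂ x₂) y.2) := by
  have hm₁ := measurable_sample h.measurable_Z₁ x₁
  have hmδ := measurable_sample h.measurable_δ x₂
  have hZ₂ (ω : Ω) := sample_autoregressive (l := fun _ => l) h.autoregressive he ω
  have hc := (measurable_carry e).comp
    (measurable_fst.prodMk (measurable_const (a := l)) :
      Measurable fun q : EuclideanSpace ℝ (Fin n₁) × EuclideanSpace ℝ (Fin n₂) => (q.1, l))
  simp only [Function.comp_def] at hc
  have hc' := hc.comp (hm₁.prodMk hmδ)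
  simp only [Function.comp_def] at hc'
  have hg₁ : Measurable fun q : EuclideanSpace ℝ (Fin n₁) × EuclideanSpace ℝ (Fin n₂) =>
      gaussDensity (mulE (design f₁ x₁) β₁) (s₁ • corr r₁ x₁) q.1 :=
    measurable_gaussDensity_smul hR₁ measurable_const measurable_const measurable_fst
  have hg₂ : Measurable fun q : EuclideanSpace ℝ (Fin n₁) × EuclideanSpace ℝ (Fin n₂) =>
      gaussDensity (mulE (design₂ f₂ x₂ e q.1) l) (s₂ • corr r₂ x₂) q.2 :=
    measurable_gaussDensity_smul hR₂ (measurable_mulE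
      (fun i j => (measurable_design₂ f₂ x₂ e i j).comp measurable_fst) measurable_const)
      measurable_const measurable_snd
  have hg := (hg₁.fun_mul hg₂).ennreal_ofReal
  refine Measure.ext_of_lintegral _ fun f hf => ?_
  simp only [hZ₂]
  rw [lintegral_map hf (by fun_prop), lintegral_withDensity_mul _ hg hf,
    Measure.volume_eq_prod, lintegral_prod _ (hg.fun_mul hf).aemeasurable]
  have hlaw := lintegral_map (μ := P)
    (f := fun q : EuclideanSpace ℝ (Fin n₁) × EuclideanSpace ℝ (Fin n₂) =>
      f (q.1, carry e q.1 l + q.2)) (by fun_prop) (hm₁.prodMk hmδ)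
  rw [h.law] at hlaw
  rw [← hlaw]
  refine (lintegral_pairLaw (θ := (s₁, β₁, s₂, l)) hR₁ hR₂ hs₁ hs₂ hf).trans ?_
  refine lintegral_congr fun u => ?_
  rw [← lintegral_const_mul' _ _ ENNReal.ofReal_ne_top]
  refine lintegral_congr fun w => ?_
  rw [← mul_assoc, ENNReal.ofReal_mul (gaussDensity_nonneg _ _ _)]

section Random

variable {Ω : Type*} [MeasurableSpace Ω] {P : Measure Ω} [IsProbabilityMeasure P]
  {s₁ : Ω → ℝ} {β₁ : Ω → EuclideanSpace ℝ (Fin p₁)} {s₂ : Ω → ℝ}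
  {l : Ω → EuclideanSpace ℝ (Unit ⊕ Fin p₂)} {Z₁ Z₂ δ : D → Ω → ℝ}

/-- `lintegral_pairLaw` averaged over the parameters; the variances must be almost surely positive
for the densities to exist. -/
lemma RandomModel.lintegral_eq (h : RandomModel P f₁ f₂ r₁ r₂ s₁ β₁ s₂ l Z₁ Z₂ δ)
    (hR₁ : (corr r₁ x₁).PosDef) (hR₂ : (corr r₂ x₂).PosDef) (he : ∀ i, x₂ i = x₁ (e i))
    (hs₁ : ∀ᵐ ω ∂P, 0 < s₁ ω) (hs₂ : ∀ᵐ ω ∂P, 0 < s₂ ω)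
    {f : Param p₁ p₂ × EuclideanSpace ℝ (Fin n₁) × EuclideanSpace ℝ (Fin n₂) → ℝ≥0∞}
    (hf : Measurable f) :
    ∫⁻ ω, f ((s₁ ω, β₁ ω, s₂ ω, l ω), sample Z₁ x₁ ω, sample Z₂ x₂ ω) ∂P =
      ∫⁻ ω, (∫⁻ u, ENNReal.ofReal
          (gaussDensity (mulE (design f₁ x₁) (β₁ ω)) (s₁ ω • corr r₁ x₁) u) *
        ∫⁻ w, ENNReal.ofReal
          (gaussDensity (mulE (design₂ f₂ x₂ e u) (l ω)) (s₂ ω • corr r₂ x₂) w) *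
            f ((s₁ ω, β₁ ω, s₂ ω, l ω), u, w)) ∂P := by
  have hm₁ := measurable_sample h.measurable_Z₁ x₁
  have hmδ := measurable_sample h.measurable_δ x₂
  have hθ : Measurable fun ω => (s₁ ω, β₁ ω, s₂ ω, l ω) :=
    h.measurable_s₁.prodMk (h.measurable_β₁.prodMk (h.measurable_s₂.prodMk h.measurable_l))
  have hc := (measurable_carry e).comp (f := fun q : Param p₁ p₂ ×
    EuclideanSpace ℝ (Fin n₁) × EuclideanSpace ℝ (Fin n₂) => (q.2.1, q.1.2.2.2)) (by fun_prop)
  simp only [Function.comp_def] at hc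
  have hZ₂ (ω : Ω) := sample_autoregressive h.autoregressive he ω
  simp only [hZ₂]
  have hpos : ∀ᵐ θ ∂P.map (fun ω => (s₁ ω, β₁ ω, s₂ ω, l ω)), 0 < θ.1 ∧ 0 < θ.2.2.1 := by
    have hms : MeasurableSet {θ : Param p₁ p₂ | 0 < θ.1 ∧ 0 < θ.2.2.1} :=
      (measurableSet_lt (f := fun _ : Param p₁ p₂ => (0 : ℝ)) (g := fun θ => θ.1)
        measurable_const (by fun_prop)).inter
        (measurableSet_lt (f := fun _ : Param p₁ p₂ => (0 : ℝ)) (g := fun θ => θ.2.2.1)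
          measurable_const (by fun_prop))
    rw [ae_map_iff hθ.aemeasurable hms]
    filter_upwards [hs₁, hs₂] with ω h1 h2 using ⟨h1, h2⟩
  have hg₁ : Measurable fun q : Param p₁ p₂ × EuclideanSpace ℝ (Fin n₁) => ENNReal.ofReal
      (gaussDensity (mulE (design f₁ x₁) q.1.2.1) (q.1.1 • corr r₁ x₁) q.2) :=
    (measurable_gaussDensity_smul hR₁ (measurable_mulE (by fun_prop) (by fun_prop))
      (by fun_prop) measurable_snd).ennreal_ofReal
  have hg₂ : Measurable fun q : (Param p₁ p₂ × EuclideanSpace ℝ (Fin n₁)) ×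
      EuclideanSpace ℝ (Fin n₂) => ENNReal.ofReal
      (gaussDensity (mulE (design₂ f₂ x₂ e q.1.2) q.1.1.2.2.2)
        (q.1.1.2.2.1 • corr r₂ x₂) q.2) :=
    (measurable_gaussDensity_smul hR₂ (measurable_mulE (fun i j =>
      (measurable_design₂ f₂ x₂ e i j).comp (by fun_prop)) (by fun_prop))
      (by fun_prop) measurable_snd).ennreal_ofReal
  have hm : Measurable fun θ : Param p₁ p₂ => ∫⁻ u, ENNReal.ofReal
          (gaussDensity (mulE (design f₁ x₁) θ.2.1) (θ.1 • corr r₁ x₁) u) *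
        ∫⁻ w, ENNReal.ofReal
          (gaussDensity (mulE (design₂ f₂ x₂ e u) θ.2.2.2) (θ.2.2.1 • corr r₂ x₂) w) *
            f (θ, u, w) :=
    Measurable.lintegral_prod_right' (f := fun q : Param p₁ p₂ × EuclideanSpace ℝ (Fin n₁) =>
      ENNReal.ofReal (gaussDensity (mulE (design f₁ x₁) q.1.2.1) (q.1.1 • corr r₁ x₁) q.2) *
        ∫⁻ w, ENNReal.ofReal
          (gaussDensity (mulE (design₂ f₂ x₂ e q.2) q.1.2.2.2) (q.1.2.2.1 • corr r₂ x₂) w) *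
            f (q.1, q.2, w))
      (hg₁.mul (Measurable.lintegral_prod_right'
        (f := fun q : (Param p₁ p₂ × EuclideanSpace ℝ (Fin n₁)) × EuclideanSpace ℝ (Fin n₂) =>
          ENNReal.ofReal (gaussDensity (mulE (design₂ f₂ x₂ e q.1.2) q.1.1.2.2.2)
            (q.1.1.2.2.1 • corr r₂ x₂) q.2) * f (q.1.1, q.1.2, q.2))
        (hg₂.mul (by fun_prop))))
  have key := lintegral_of_condDistrib_ae_eq hθ (hm₁.prodMk hmδ) (h.law n₁ n₂ x₁ x₂)
    (f := fun q => f (q.1, q.2.1, carry e q.2.1 q.1.2.2.2 + q.2.2)) (by fun_prop)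
  refine key.trans ?_
  rw [← lintegral_map hm hθ]
  refine lintegral_congr_ae ?_
  filter_upwards [hpos] with θ hθpos
  exact lintegral_pairLaw hR₁ hR₂ hθpos.1 hθpos.2 (k := fun q => f (θ, q)) (by fun_prop)

lemma RandomModel.lintegral_first (h : RandomModel P f₁ f₂ r₁ r₂ s₁ β₁ s₂ l Z₁ Z₂ δ)
    (hR₁ : (corr r₁ x₁).PosDef) (hR₂ : (corr r₂ x₂).PosDef) (he : ∀ i, x₂ i = x₁ (e i))
    (hs₁ : ∀ᵐ ω ∂P, 0 < s₁ ω) (hs₂ : ∀ᵐ ω ∂P, 0 < s₂ ω)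
    {f : Param p₁ p₂ × EuclideanSpace ℝ (Fin n₁) → ℝ≥0∞} (hf : Measurable f) :
    ∫⁻ ω, f ((s₁ ω, β₁ ω, s₂ ω, l ω), sample Z₁ x₁ ω) ∂P =
      ∫⁻ ω, (∫⁻ u, ENNReal.ofReal
          (gaussDensity (mulE (design f₁ x₁) (β₁ ω)) (s₁ ω • corr r₁ x₁) u) *
            f ((s₁ ω, β₁ ω, s₂ ω, l ω), u)) ∂P := by
  refine (h.lintegral_eq hR₁ hR₂ he hs₁ hs₂ (f := fun q => f (q.1, q.2.1)) (by fun_prop)).trans ?_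
  refine lintegral_congr_ae ?_
  filter_upwards [hs₂] with ω hω
  refine lintegral_congr fun u => ?_
  -- The second-level density has total mass 1 and integrates out.
  rw [lintegral_mul_const _ (measurable_gaussDensity _ _).ennreal_ofReal, lintegral_gaussDensity _ (hR₂.smul hω), one_mul]

/-- Given all parameters and `z₁`, the law of `z₂` involves only `z₁`, λ and σ₂². Integrating out
`z₂` leaves a function of the parameters and `z₁`, to which the first-level identity is applied
backwards. -/
lemma RandomModel.lintegral_second (h : RandomModel P f₁ f₂ r₁ r₂ s₁ β₁ s₂ l Z₁ Z₂ δ)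
    (hR₁ : (corr r₁ x₁).PosDef) (hR₂ : (corr r₂ x₂).PosDef) (he : ∀ i, x₂ i = x₁ (e i))
    (hs₁ : ∀ᵐ ω ∂P, 0 < s₁ ω) (hs₂ : ∀ᵐ ω ∂P, 0 < s₂ ω)
    {f : EuclideanSpace ℝ (Fin n₁) × ℝ × EuclideanSpace ℝ (Unit ⊕ Fin p₂) ×
      EuclideanSpace ℝ (Fin n₂) → ℝ≥0∞} (hf : Measurable f) :
    ∫⁻ ω, f (sample Z₁ x₁ ω, s₂ ω, l ω, sample Z₂ x₂ ω) ∂P =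
      ∫⁻ ω, (∫⁻ w, ENNReal.ofReal
          (gaussDensity (mulE (design₂ f₂ x₂ e (sample Z₁ x₁ ω)) (l ω)) (s₂ ω • corr r₂ x₂) w) *
            f (sample Z₁ x₁ ω, s₂ ω, l ω, w)) ∂P := by
  have hg₂ : Measurable fun q : (Param p₁ p₂ × EuclideanSpace ℝ (Fin n₁)) ×
      EuclideanSpace ℝ (Fin n₂) => ENNReal.ofReal
      (gaussDensity (mulE (design₂ f₂ x₂ e q.1.2) q.1.1.2.2.2)
        (q.1.1.2.2.1 • corr r₂ x₂) q.2) * f (q.1.2, q.1.1.2.2.1, q.1.1.2.2.2, q.2) :=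
    (measurable_gaussDensity_smul hR₂ (measurable_mulE (fun i j =>
      (measurable_design₂ f₂ x₂ e i j).comp (by fun_prop)) (by fun_prop))
      (by fun_prop) measurable_snd).ennreal_ofReal.mul (by fun_prop)
  exact (h.lintegral_eq hR₁ hR₂ he hs₁ hs₂
    (f := fun q => f (q.2.1, q.1.2.2.1, q.1.2.2.2, q.2.2)) (by fun_prop)).trans
    (h.lintegral_first hR₁ hR₂ he hs₁ hs₂ hg₂.lintegral_prod_right').symm

end Random

end CoKrigingModel


/-! ### The first level as the case of a constant design variable. -/

lemma condDistrib_unit_ae_eq {Ω : Type*} [MeasurableSpace Ω] {P : Measure Ω}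
    [IsProbabilityMeasure P] {S : Ω → ℝ} (hS : Measurable S) {ν : Measure ℝ} [IsProbabilityMeasure ν]
    (h : P.map S = ν) :
    condDistrib S (fun _ => ()) P =ᵐ[P.map fun _ => ()] fun _ => ν := by
  refine condDistrib_ae_eq_of_measure_eq_compProd (κ := Kernel.const Unit ν) _ hS.aemeasurable ?_
  have hu : P.map (fun _ => ()) = Measure.dirac () := by simp
  rw [hu, Measure.dirac_unit_compProd_const, ← h, Measure.map_map (by fun_prop) hS]
  rfl

/-- Informative priors, first level. -/
theorem informative_first {Ω ι κ : Type*} [MeasurableSpace Ω] [Fintype ι] [DecidableEq ι]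
    [Fintype κ] [DecidableEq κ] {P : Measure Ω} [IsProbabilityMeasure P]
    {S : Ω → ℝ} {B : Ω → EuclideanSpace ℝ κ} {Z : Ω → EuclideanSpace ℝ ι}
    {F : Matrix ι κ ℝ} {R : Matrix ι ι ℝ} {V : Matrix κ κ ℝ} {b : EuclideanSpace ℝ κ} {α γ : ℝ}
    (hS : Measurable S) (hB : Measurable B) (hZ : Measurable Z) (hR : R.PosDef) (hV : V.PosDef)
    (hα : 0 < α) (hγ : 0 < γ) (hSlaw : P.map S = invGamma α γ)
    (hBlaw : condDistrib B S P =ᵐ[P.map S] fun s => multivariateGaussian b (s • V))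
    (hZlaw : ∀ f : ℝ × EuclideanSpace ℝ κ × EuclideanSpace ℝ ι → ℝ≥0∞, Measurable f →
      ∫⁻ ω, f (S ω, B ω, Z ω) ∂P = ∫⁻ ω, (∫⁻ z,
        ENNReal.ofReal (gaussDensity (mulE F (B ω)) (S ω • R) z) * f (S ω, B ω, z)) ∂P) :
    (∀ᵐ y ∂P.map (fun ω => (Z ω, S ω)), condDistrib B (fun ω => (Z ω, S ω)) P y =
      multivariateGaussian (mulE (covI F R V y.2) (nuI F R V b y.1 y.2)) (covI F R V y.2)) ∧
    (LinearIndependent ℝ F.col → ∀ᵐ y ∂P.map Z, condDistrib S Z P y =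
      invGamma ((Fintype.card ι : ℝ) / 2 + α) (scaleI F R V b γ y / 2)) := by
  have hprob := isProbabilityMeasure_invGamma hα hγ
  have hX : Measurable fun _ : Ω => () := measurable_const
  -- Pairing with a constant does not change the conditioning; the same transfer is undone in the
  -- conclusions below.
  have hBlaw' : condDistrib B (fun ω => ((), S ω)) P =ᵐ[P.map fun ω => ((), S ω)]
      fun y => multivariateGaussian b (y.2 • V) := by
    have h1 := condDistrib_comp_leftInverse (P := P) (hX.prodMk hS) hB
      (e := Prod.snd) (g := fun s => ((), s)) measurable_snd (by fun_prop) fun y => rfl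
    have h2 : P.map S = (P.map fun ω => ((), S ω)).map Prod.snd := by
      rw [Measure.map_map measurable_snd (hX.prodMk hS)]
      rfl
    rw [h2] at hBlaw
    filter_upwards [h1, ae_of_ae_map measurable_snd.aemeasurable hBlaw] with y hy1 hy2
    rw [hy1, hy2]
  have hjoint := fun f (hf : Measurable f) => lintegral_conjugate_joint (P := P) (Z := Z)
    (F := fun _ : Unit => F) hX hS hB
    (fun _ _ => measurable_const) hR hV (condDistrib_unit_ae_eq hS hSlaw) hBlaw'
    (fun f hf => hZlaw (fun q => f ((), q)) (by fun_prop)) (f := f) hf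
  constructor
  · have hY : Measurable fun ω => (Z ω, S ω) := hZ.prodMk hS
    have h1 := condDistrib_coeff_ae_eq (F := fun _ : Unit => F) (b := b)
      hX hS hB hZ (fun _ _ => measurable_const) hR hV hα hγ hjoint
    have h2 := condDistrib_comp_leftInverse (P := P) hY hB
      (e := fun w => ((), w)) (g := Prod.snd) (by fun_prop) measurable_snd fun y => rfl
    have h3 : P.map (fun ω => ((), Z ω, S ω)) =
        (P.map fun ω => (Z ω, S ω)).map fun w => ((), w) := by
      rw [Measure.map_map (by fun_prop) hY]
      rfl
    rw [h3] at h1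
    filter_upwards [h2, ae_of_ae_map (by fun_prop) h1] with y hy2 hy1
    rw [hy2, hy1]
  · intro hli
    have h1 := condDistrib_variance_ae_eq (F := fun _ : Unit => F) (b := b)
      hX hS hZ (fun _ _ => measurable_const) hR hV hα hγ hjoint
    have h2 := condDistrib_comp_leftInverse (P := P) hZ hS
      (e := fun w => ((), w)) (g := Prod.snd) (by fun_prop) measurable_snd fun y => rfl
    have h3 : P.map (fun ω => ((), Z ω)) = (P.map Z).map fun w => ((), w) := by
      rw [Measure.map_map (by fun_prop) hZ]
      rfl
    rw [h3] at h1
    filter_upwards [h2, ae_of_ae_map (by fun_prop) h1] with y hy2 hy1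
    rw [hy2, hy1 hli]

end CoKriging

end

/-! ### Assembly of the two levels and the two kinds of priors. -/

theorem mainTheorem5
    {Ω : Type*} [MeasurableSpace Ω]
    {d p₁ p₂ n₁ n₂ : ℕ} (D : Set (EuclideanSpace ℝ (Fin d)))
    (f₁ : D → Fin p₁ → ℝ) (f₂ : D → Fin p₂ → ℝ)
    (r₁ r₂ : EuclideanSpace ℝ (Fin d) → ℝ)
    (hr₁ : CoKriging.IsCorrelation D r₁) (hr₂ : CoKriging.IsCorrelation D r₂)
    (x₁ : Fin n₁ → D) (x₂ : Fin n₂ → D)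
    (e : Fin n₂ → Fin n₁) (he : ∀ i, x₂ i = x₁ (e i))
    (F₁ : Matrix (Fin n₁) (Fin p₁) ℝ) (hF₁ : F₁ = CoKriging.design f₁ x₁)
    (F : EuclideanSpace ℝ (Fin n₁) → Matrix (Fin n₂) (Unit ⊕ Fin p₂) ℝ)
    (hF : F = CoKriging.design₂ f₂ x₂ e)
    (R₁ : Matrix (Fin n₁) (Fin n₁) ℝ) (hR₁ : R₁ = CoKriging.corr r₁ x₁) (hR₁pos : R₁.PosDef)
    (R₂ : Matrix (Fin n₂) (Fin n₂) ℝ) (hR₂ : R₂ = CoKriging.corr r₂ x₂) (hR₂pos : R₂.PosDef) :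
    -- Case (I): informative priors
    (∀ (b₁ : EuclideanSpace ℝ (Fin p₁)) (v₁ : Fin p₁ → ℝ) (α₁ γ₁ : ℝ)
        (bl : EuclideanSpace ℝ (Unit ⊕ Fin p₂)) (vl : Unit ⊕ Fin p₂ → ℝ) (α₂ γ₂ : ℝ),
      (∀ k, 0 < v₁ k) → (∀ k, 0 < vl k) → 0 < α₁ → 0 < γ₁ → 0 < α₂ → 0 < γ₂ →
      ∀ (P : Measure Ω) [IsProbabilityMeasure P]
        (s₁ : Ω → ℝ) (β₁ : Ω → EuclideanSpace ℝ (Fin p₁))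
        (s₂ : Ω → ℝ) (l : Ω → EuclideanSpace ℝ (Unit ⊕ Fin p₂)) (Z₁ Z₂ δ : D → Ω → ℝ)
        (z₁ : Ω → EuclideanSpace ℝ (Fin n₁)) (z₂ : Ω → EuclideanSpace ℝ (Fin n₂)),
      CoKriging.RandomModel P f₁ f₂ r₁ r₂ s₁ β₁ s₂ l Z₁ Z₂ δ →
      z₁ = CoKriging.sample Z₁ x₁ → z₂ = CoKriging.sample Z₂ x₂ →
      CoKriging.InformativePriors P s₁ β₁ s₂ l z₁ b₁ v₁ α₁ γ₁ bl vl α₂ γ₂ →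
      (∀ᵐ y ∂(P.map fun ω => (z₁ ω, s₁ ω)),
        condDistrib β₁ (fun ω => (z₁ ω, s₁ ω)) P y =
          multivariateGaussian
            (CoKriging.mulE (CoKriging.covI F₁ R₁ (Matrix.diagonal v₁) y.2)
              (CoKriging.nuI F₁ R₁ (Matrix.diagonal v₁) b₁ y.1 y.2))
            (CoKriging.covI F₁ R₁ (Matrix.diagonal v₁) y.2)) ∧
      (∀ᵐ y ∂(P.map fun ω => (z₁ ω, z₂ ω, s₂ ω)),
        condDistrib l (fun ω => (z₁ ω, z₂ ω, s₂ ω)) P y =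
          multivariateGaussian
            (CoKriging.mulE (CoKriging.covI (F y.1) R₂ (Matrix.diagonal vl) y.2.2)
              (CoKriging.nuI (F y.1) R₂ (Matrix.diagonal vl) bl y.2.1 y.2.2))
            (CoKriging.covI (F y.1) R₂ (Matrix.diagonal vl) y.2.2)) ∧
      (LinearIndependent ℝ F₁.col →
        ∀ᵐ y ∂(P.map z₁),
          condDistrib s₁ z₁ P y =
            CoKriging.invGamma ((n₁ : ℝ) / 2 + α₁)
              (CoKriging.scaleI F₁ R₁ (Matrix.diagonal v₁) b₁ γ₁ y / 2)) ∧
      (∀ᵐ y ∂(P.map fun ω => (z₁ ω, z₂ ω)),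
        LinearIndependent ℝ (F y.1).col →
          condDistrib s₂ (fun ω => (z₁ ω, z₂ ω)) P y =
            CoKriging.invGamma ((n₂ : ℝ) / 2 + α₂)
              (CoKriging.scaleI (F y.1) R₂ (Matrix.diagonal vl) bl γ₂ y.2 / 2))) ∧
    -- The likelihood: density of the observations, `p(z₁ | β₁, σ₁²) p(z₂ | z₁, ρ, β₂, σ₂²)`
    (∀ (s₁ : ℝ) (β₁ : EuclideanSpace ℝ (Fin p₁)) (s₂ : ℝ)
        (l : EuclideanSpace ℝ (Unit ⊕ Fin p₂)), 0 < s₁ → 0 < s₂ →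
      ∀ (P : Measure Ω) [IsProbabilityMeasure P] (Z₁ Z₂ δ : D → Ω → ℝ),
      CoKriging.FixedModel P f₁ f₂ r₁ r₂ (s₁, β₁, s₂, l) Z₁ Z₂ δ →
      P.map (fun ω => (CoKriging.sample Z₁ x₁ ω, CoKriging.sample Z₂ x₂ ω)) =
        volume.withDensity fun y => ENNReal.ofReal
          (CoKriging.gaussDensity (CoKriging.mulE F₁ β₁) (s₁ • R₁) y.1 *
            CoKriging.gaussDensity (CoKriging.mulE (F y.1) l) (s₂ • R₂) y.2)) ∧
    -- Case (II): non-informative priors, first level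
    (∀ z₁ : EuclideanSpace ℝ (Fin n₁), LinearIndependent ℝ F₁.col →
      (∀ s : ℝ, 0 < s →
        0 < CoKriging.evidence volume
          (fun β => CoKriging.gaussDensity (CoKriging.mulE F₁ β) (s • R₁) z₁) ∧
        CoKriging.evidence volume
          (fun β => CoKriging.gaussDensity (CoKriging.mulE F₁ β) (s • R₁) z₁) < ⊤ ∧
        CoKriging.bayes volume
            (fun β => CoKriging.gaussDensity (CoKriging.mulE F₁ β) (s • R₁) z₁) =
          multivariateGaussian
            (CoKriging.mulE (CoKriging.covII F₁ R₁ s) (CoKriging.nuII F₁ R₁ z₁ s))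
            (CoKriging.covII F₁ R₁ s)) ∧
      (z₁ ∉ Set.range (CoKriging.mulE F₁) →
        0 < CoKriging.evidence (volume.prod CoKriging.jeffreys)
          (fun q => CoKriging.gaussDensity (CoKriging.mulE F₁ q.1) (q.2 • R₁) z₁) ∧
        CoKriging.evidence (volume.prod CoKriging.jeffreys)
          (fun q => CoKriging.gaussDensity (CoKriging.mulE F₁ q.1) (q.2 • R₁) z₁) < ⊤ ∧
        (CoKriging.bayes (volume.prod CoKriging.jeffreys)
            (fun q => CoKriging.gaussDensity (CoKriging.mulE F₁ q.1) (q.2 • R₁) z₁)).map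
              Prod.snd =
          CoKriging.invGamma (((n₁ : ℝ) - p₁) / 2) (CoKriging.scaleII F₁ R₁ z₁ / 2))) ∧
    -- Case (II): non-informative priors, second level
    (∀ (z₁ : EuclideanSpace ℝ (Fin n₁)) (z₂ : EuclideanSpace ℝ (Fin n₂)),
      LinearIndependent ℝ (F z₁).col →
      (∀ s : ℝ, 0 < s →
        0 < CoKriging.evidence volume
          (fun l => CoKriging.gaussDensity (CoKriging.mulE (F z₁) l) (s • R₂) z₂) ∧
        CoKriging.evidence volume
          (fun l => CoKriging.gaussDensity (CoKriging.mulE (F z₁) l) (s • R₂) z₂) < ⊤ ∧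
        CoKriging.bayes volume
            (fun l => CoKriging.gaussDensity (CoKriging.mulE (F z₁) l) (s • R₂) z₂) =
          multivariateGaussian
            (CoKriging.mulE (CoKriging.covII (F z₁) R₂ s) (CoKriging.nuII (F z₁) R₂ z₂ s))
            (CoKriging.covII (F z₁) R₂ s)) ∧
      (z₂ ∉ Set.range (CoKriging.mulE (F z₁)) →
        0 < CoKriging.evidence (volume.prod CoKriging.jeffreys)
          (fun q => CoKriging.gaussDensity (CoKriging.mulE (F z₁) q.1) (q.2 • R₂) z₂) ∧
        CoKriging.evidence (volume.prod CoKriging.jeffreys)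
          (fun q => CoKriging.gaussDensity (CoKriging.mulE (F z₁) q.1) (q.2 • R₂) z₂) < ⊤ ∧
        (CoKriging.bayes (volume.prod CoKriging.jeffreys)
            (fun q => CoKriging.gaussDensity (CoKriging.mulE (F z₁) q.1) (q.2 • R₂) z₂)).map
              Prod.snd =
          CoKriging.invGamma (((n₂ : ℝ) - p₂ - 1) / 2)
            (CoKriging.scaleII (F z₁) R₂ z₂ / 2))) := by
  subst hF₁ hF hR₁ hR₂
  refine ⟨?_, ?_, ?_, ?_⟩
  · intro b₁ v₁ α₁ γ₁ bl vl α₂ γ₂ hv₁ hvl hα₁ hγ₁ hα₂ hγ₂ P _ s₁ β₁ s₂ l Z₁ Z₂ δ z₁ z₂ h hz₁ hz₂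
      hprior
    subst hz₁ hz₂
    have hm₁ := CoKriging.measurable_sample h.measurable_Z₁ x₁
    have hm₂ : Measurable (CoKriging.sample Z₂ x₂) := by
      refine CoKriging.measurable_sample (fun x => ?_) x₂
      have hl := h.measurable_l
      have hZ := h.measurable_Z₁ x
      have hδ := h.measurable_δ x
      have hx : Z₂ x = fun ω => CoKriging.rho (l ω) * Z₁ x ω + δ x ω :=
        funext fun ω => h.autoregressive x ω
      rw [hx]
      unfold CoKriging.rho
      fun_prop
    have hs₁ : ∀ᵐ ω ∂P, 0 < s₁ ω := by
      refine ae_of_ae_map h.measurable_s₁.aemeasurable (p := fun s => 0 < s) ?_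
      rw [hprior.prior_s₁]
      exact CoKriging.ae_invGamma_pos α₁ γ₁
    have hs₂ : ∀ᵐ ω ∂P, 0 < s₂ ω :=
      ae_of_ae_map (hm₁.prodMk h.measurable_s₂).aemeasurable
        (CoKriging.ae_pos_of_condDistrib_eq_invGamma h.measurable_s₂ hprior.prior_s₂)
    have hV₁ : (Matrix.diagonal v₁).PosDef := Matrix.PosDef.diagonal hv₁
    have hVl : (Matrix.diagonal vl).PosDef := Matrix.PosDef.diagonal hvl
    have hfirst := CoKriging.informative_first h.measurable_s₁ h.measurable_β₁ hm₁ hR₁pos hV₁ hα₁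
      hγ₁ hprior.prior_s₁ hprior.prior_β₁ fun f hf =>
        h.lintegral_first hR₁pos hR₂pos he hs₁ hs₂
          (f := fun q => f (q.1.1, q.1.2.1, q.2)) (by fun_prop)
    have hjoint := fun f (hf : Measurable f) => CoKriging.lintegral_conjugate_joint hm₁
      h.measurable_s₂ h.measurable_l (CoKriging.measurable_design₂ f₂ x₂ e) hR₂pos hVl
      hprior.prior_s₂ hprior.prior_l
      (fun f hf => h.lintegral_second hR₁pos hR₂pos he hs₁ hs₂ hf) (f := f) hf
    refine ⟨hfirst.1, ?_, by simpa using hfirst.2, ?_⟩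
    · exact CoKriging.condDistrib_coeff_ae_eq hm₁ h.measurable_s₂ h.measurable_l hm₂
        (CoKriging.measurable_design₂ f₂ x₂ e) hR₂pos hVl hα₂ hγ₂ hjoint
    · simpa using CoKriging.condDistrib_variance_ae_eq hm₁ h.measurable_s₂ hm₂
        (CoKriging.measurable_design₂ f₂ x₂ e) hR₂pos hVl hα₂ hγ₂ hjoint
  · intro s₁ β₁ s₂ l hs₁ hs₂ P _ Z₁ Z₂ δ h
    exact h.map_sample hR₁pos hR₂pos he hs₁ hs₂
  · intro z₁ hli
    refine ⟨fun s hs => CoKriging.bayes_flat hR₁pos hli z₁ hs, fun hz => ?_⟩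
    simpa using CoKriging.bayes_jeffreys hR₁pos hli hz
  · intro z₁ z₂ hli
    refine ⟨fun s hs => CoKriging.bayes_flat hR₂pos hli z₂ hs, fun hz => ?_⟩
    -- The second design has 1 + p₂ columns, the extra one belonging to ρ.
    have hcard : (n₂ : ℝ) - p₂ - 1 = n₂ - (Fintype.card (Unit ⊕ Fin p₂) : ℝ) := by
      simp
      ring
    rw [hcard]
    simpa only [Fintype.card_fin] using CoKriging.bayes_jeffreys hR₂pos hli hz
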